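/- Let $\Gamma_0$ be a connected Dynkin graph with vertex set $I_0$, given by an irreducible, reduced, crystallographic finite root system with simple roots $\alpha_i$ and simple coroots $\alpha_i^\vee$ $(i\in I_0)$; let $\theta=\sum_{i\in I_0}\delta_i\alpha_i$ be its longest (highest) root. Let $\Gamma$ be the extended Dynkin graph of $\Gamma_0$, with vertex set $I=I_0\sqcup\{i_0\}$ and Cartan matrix $c_{ij}=\langle\alpha_j,\alpha_i^\vee\rangle$ $(i,j\in I)$, where the extending vertex $i_0$ is represented by the root $-\theta$. Put $\delta_{i_0}=1$, $\delta=(\delta_i)_{i\in I}$. For $v\in\mathbb R^I$ and $i\in I$ let $f_i(v)_i=-v_i$ and $f_i(v)_j=v_j-c_{ij}v_i$ for $j\ne i$. The affine Weyl group $W$ is the group generated by the simple reflections $s_i=f_i$ $(i\in I)$ acting on $\mathbb R^I$, and $l(g)$ is the minimal number of simple reflections with product $g$; the finite Weyl group $W_0$ acts on $\mathbb R^{I_0}$ in the same way. For $v\in\mathbb R^I$ with $v_i<-1$, the passage from $v$ to $f_i(v)$ is called a firing of a vertex of amplitude $<-1$. For $u\in\mathbb R^{I_0}$ let $\widetilde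 u\in\mathbb R^I$ be the unique vector that extends $u$ and satisfies $\delta\cdot\widetilde u=0$. Let $\rho=(1,\dots,1)\in\mathbb R^{I_0}$, and let $W_0^{(i_0)}$ be the set of those $g\in W_0$ for which $\widetilde{g\rho}$ can be obtained from $\widetilde\rho$ by a finite (possibly empty) sequence of firings of vertices of amplitude $<-1$. Let $\Gamma(W_0^{(i_0)})$ be the directed graph with vertex set $W_0^{(i_0)}$ and an edge $g\to h$ whenever $\widetilde{h\rho}$ is obtained from $\widetilde{g\rho}$ by firing a single vertex of amplitude $<-1$. For $\kappa>0$ let $\mathcal H_\kappa=\{v\in\mathbb R^I:\delta\cdot v=\kappa\}$, let $C_e=\{v\in\mathcal H_\kappa: v_i\ge 0\ \forall i\in I\}$ be the dominant Weyl chamber, and let $\mathcal K_\kappa=\{v\in\mathcal H_\kappa: v_i\in[0,\kappa]\ \forall i\in I_0\}$ be the unit hypercube. The Weyl chambers are the sets $gC_e$, $g\in W$. The dual directed graph of the triangulation of $\mathcal K_\kappa$ by Weyl chambers has as vertices the Weyl chambers contained in $\mathcal K_\kappa$; two of them are joined by an edge when they share a facet, and the edge is oriented $gC_e\to gs_iC_e$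 when $l(g)<l(gs_i)$. Proposition. For every $\kappa>0$, the hypercube $\mathcal K_\kappa$ is the union of the Weyl chambers contained in it, and the directed graph $\Gamma(W_0^{(i_0)})$ is isomorphic to the dual directed graph of the triangulation of $\mathcal K_\kappa$ by Weyl chambers. -/

import Mathlib

noncomputable section

namespace NumbersGame

/-! ### The numbers game and the reflection group attached to an integral Cartan matrix -/

section General

variable {I : Type*}

open Classical in
/-- The value at `v` of the simple reflection `f_i` of the numbers game attached to the Cartan
matrix `C = (c_ij)`: the amplitude `v i` changes its sign and `v j` becomes `v j - c_ij * v i` for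
`j ≠ i` (so `v j` does not change if `j` is not adjacent to `i`, where `c_ij = 0`). -/
def fireFun (C : Matrix I I ℤ) (i : I) (v : I → ℝ) : I → ℝ :=
  fun j => if j = i then -v i else v j - (C i j : ℝ) * v i

theorem fireFun_fireFun (C : Matrix I I ℤ) (i : I) (v : I → ℝ) :
    fireFun C i (fireFun C i v) = v := by
  funext j
  by_cases h : j = i
  · subst h; simp [fireFun]
  · simp [fireFun, h]

/-- The simple reflection `f_i` as a linear automorphism of the space `ℝ^I` of configurations. -/
def fire (C : Matrix I I ℤ) (i : I) : (I → ℝ) ≃ₗ[ℝ] (I → ℝ) where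
  toFun := fireFun C i
  map_add' v w := by
    funext j
    by_cases h : j = i
    · subst h; simp [fireFun]; ring
    · simp [fireFun, h]; ring
  map_smul' a v := by
    funext j
    by_cases h : j = i
    · subst h; simp [fireFun]
    · simp [fireFun, h]; ring
  invFun := fireFun C i
  left_inv := fireFun_fireFun C i
  right_inv := fireFun_fireFun C i

/-- The Weyl group of the Cartan matrix `C`, in its reflection representation on `ℝ^I`: the group
generated by the simple reflections `f_i`. -/
def weylGroup (C : Matrix I I ℤ) : Subgroup ((I → ℝ) ≃ₗ[ℝ] (I → ℝ)) :=
  Subgroup.closure (Set.range (fire C))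

/-- The simple reflection `s_i` as an element of the Weyl group. -/
def simpleReflection (C : Matrix I I ℤ) (i : I) : weylGroup C :=
  ⟨fire C i, Subgroup.subset_closure ⟨i, rfl⟩⟩

/-- The length of `g`: the minimal number of simple reflections whose product is `g`. -/
def length (C : Matrix I I ℤ) (g : weylGroup C) : ℕ :=
  sInf {n | ∃ word : List I, word.length = n ∧ (word.map (simpleReflection C)).prod = g}

/-- `w` is obtained from `v` by firing one vertex of amplitude `< -1`. -/
def FiresTo (C : Matrix I I ℤ) (v w : I → ℝ) : Prop :=
  ∃ i, v i < -1 ∧ w = fire C i v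

/-- `w` is obtainable from `v` by a (possibly empty) sequence of firings of vertices of
amplitude `< -1`. -/
def Obtainable (C : Matrix I I ℤ) (v w : I → ℝ) : Prop :=
  Relation.ReflTransGen (FiresTo C) v w

/-- The image `g A` of a set `A` of configurations under an element `g` of the Weyl group. -/
def translate (C : Matrix I I ℤ) (g : weylGroup C) (A : Set (I → ℝ)) : Set (I → ℝ) :=
  (fun v => (g : (I → ℝ) ≃ₗ[ℝ] (I → ℝ)) v) '' A

/-- Two convex polytopes share a facet: they meet in a set whose dimension is one less than the
dimension of the two polytopes. -/
def ShareFacet (A B : Set (I → ℝ)) : Prop :=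
  (A ∩ B).Nonempty ∧
  Module.finrank ℝ (vectorSpan ℝ (A ∩ B)) + 1 = Module.finrank ℝ (vectorSpan ℝ A) ∧
  Module.finrank ℝ (vectorSpan ℝ (A ∩ B)) + 1 = Module.finrank ℝ (vectorSpan ℝ B)

/-- The chambers `g Ce`, `g` in the Weyl group, which are contained in `K`. -/
def chambersIn (C : Matrix I I ℤ) (Ce K : Set (I → ℝ)) : Set (Set (I → ℝ)) :=
  {A | (∃ g : weylGroup C, A = translate C g Ce) ∧ A ⊆ K}

/-- The dual directed graph of a polytope `K` which is a union of chambers `g Ce`: the vertices are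
the chambers in `K`, two of them are joined by an edge if they share a facet, and this edge is
oriented as `g Ce → g s_i Ce` when `l(g) < l(g s_i)`. -/
def dualDigraph (C : Matrix I I ℤ) (Ce K : Set (I → ℝ)) : Digraph (chambersIn C Ce K) where
  Adj A B := ShareFacet (A : Set (I → ℝ)) (B : Set (I → ℝ)) ∧
    ∃ (g : weylGroup C) (i : I),
      (A : Set (I → ℝ)) = translate C g Ce ∧
      (B : Set (I → ℝ)) = translate C (g * simpleReflection C i) Ce ∧
      length C g < length C (g * simpleReflection C i)

end General

/-! ### Extended Dynkin graphs

The Dynkin graph `Γ₀` is given by a root system `P` with a base `b`; its vertex set `I₀` is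
`b.support`. If `θ` is (the index of) the longest root, then the extended Dynkin graph `Γ` has the
vertex set `I = Option b.support`, where `none` is the extending vertex `i₀`. -/

section Extended

variable {ι M N : Type*} [AddCommGroup M] [Module ℝ M] [AddCommGroup N] [Module ℝ N]
  {P : RootPairing ι ℝ M N}

/-- `θ` is the longest (highest) root: it has maximal height, i.e. it is the sum of the greatest
number of simple roots. -/
def IsLongestRoot (b : P.Base) (θ : ι) : Prop :=
  ∀ j, b.height j ≤ b.height θ

/-- The Cartan matrix of `Γ₀`, in the convention `c_ij = ⟨α_j, α_i^∨⟩` of the numbers game. -/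
def finiteCartan [P.IsCrystallographic] (b : P.Base) : Matrix b.support b.support ℤ :=
  fun i j => P.pairingIn ℤ j i

/-- The finite parts of the affine simple roots: `α_i` for `i ∈ I₀`, and `-θ` for the extending
vertex, whose affine simple root is `δ - θ`. -/
def simpleRootIndex (b : P.Base) (θ : ι) : Option b.support → ι
  | none => P.reflectionPerm θ θ
  | some i => i

/-- The Cartan matrix of `Γ`, in the same convention as for `Γ₀`. -/
def affineCartan [P.IsCrystallographic] (b : P.Base) (θ : ι) :
    Matrix (Option b.support) (Option b.support) ℤ :=
  fun i j => P.pairingIn ℤ (simpleRootIndex b θ j) (simpleRootIndex b θ i)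

variable [P.IsRootSystem]

/-- The coordinates of `δ = α_{i₀} + θ` in the basis of (affine) simple roots. -/
def delta (b : P.Base) (θ : ι) : Option b.support → ℝ
  | none => 1
  | some i => b.toWeightBasis.repr (P.root θ) i

/-- The configuration `ũ` on `Γ` which restricts to `u` on `Γ₀` and satisfies `δ · ũ = 0`. -/
def lift (b : P.Base) (θ : ι) (u : b.support → ℝ) : Option b.support → ℝ
  | none => -∑ i, delta b θ (some i) * u i
  | some i => u i

theorem delta_dotProduct_lift (b : P.Base) (θ : ι) (u : b.support → ℝ) :
    delta b θ ⬝ᵥ lift b θ u = 0 := by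
  simp [dotProduct, Fintype.sum_option, delta, lift]

theorem eq_lift (b : P.Base) (θ : ι) (u : b.support → ℝ) (v : Option b.support → ℝ)
    (h : delta b θ ⬝ᵥ v = 0) (hv : ∀ i, v (some i) = u i) : v = lift b θ u := by
  funext j
  cases j with
  | some i => exact hv i
  | none =>
    simp only [dotProduct, Fintype.sum_option, delta, hv, one_mul] at h
    simp only [lift, delta]
    linarith

/-- The configuration `ρ` on `Γ₀`, all of whose amplitudes are `1`. -/
def rho (b : P.Base) : b.support → ℝ := fun _ => 1

/-- The hyperplane `H_κ` of the configurations `v` on `Γ` with `δ · v = κ`. -/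
def hyperplane (b : P.Base) (θ : ι) (κ : ℝ) : Set (Option b.support → ℝ) :=
  {v | delta b θ ⬝ᵥ v = κ}

/-- The dominant Weyl chamber `C_e` in `H_κ`. -/
def dominantChamber (b : P.Base) (θ : ι) (κ : ℝ) : Set (Option b.support → ℝ) :=
  {v | v ∈ hyperplane b θ κ ∧ ∀ i, 0 ≤ v i}

/-- The unit hypercube `K_κ` in `H_κ`; the condition is on the vertices of `Γ₀` only. -/
def unitHypercube (b : P.Base) (θ : ι) (κ : ℝ) : Set (Option b.support → ℝ) :=
  {v | v ∈ hyperplane b θ κ ∧ ∀ i : b.support, v (some i) ∈ Set.Icc 0 κ}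

variable [P.IsCrystallographic]

/-- The configuration `(g ρ)~` on `Γ`, for `g` in the finite Weyl group `W₀` of `Γ₀`. -/
def liftRho (b : P.Base) (θ : ι) (g : weylGroup (finiteCartan b)) : Option b.support → ℝ :=
  lift b θ ((g : (b.support → ℝ) ≃ₗ[ℝ] (b.support → ℝ)) (rho b))

/-- The subset `W₀^{(i₀)}` of `W₀`: those `g` for which `(g ρ)~` is obtainable from `ρ~` by firing
vertices of amplitude `< -1`. -/
def W0i0 (b : P.Base) (θ : ι) : Set (weylGroup (finiteCartan b)) :=
  {g | Obtainable (affineCartan b θ) (lift b θ (rho b)) (liftRho b θ g)}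

/-- The directed graph `Γ(W₀^{(i₀)})`: there is an edge `g → h` if `(h ρ)~` is obtained from
`(g ρ)~` by firing a single vertex of amplitude `< -1`. -/
def firingDigraph (b : P.Base) (θ : ι) : Digraph (W0i0 b θ) where
  Adj g h := FiresTo (affineCartan b θ) (liftRho b θ g) (liftRho b θ h)

end Extended

end NumbersGame

end

/-! Fix an interior point `p` of the dominant chamber. Chambers inside the cube correspond to the
`g` in the affine group for which `g • p` satisfies the strict cube inequalities (`InCube`). Both
digraphs are identified with the graph on these `g` whose edges are the length-increasing steps `g →
g s_i`. On the firing side `g` goes to `g⁻¹ ρ̃`, so that firing `i` is the passage from `g` to `g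
s_i`.

The amplitude `(g⁻¹ ρ̃)_i` is the value at `ρ̃` of the affine root `g α_i = β + kδ`. Since `δ`
vanishes at `ρ̃`, it equals the height of `β`. The same root vanishes on the wall between `g C_e`
and `g s_i C_e`, while the facets of the cube belong to `α_j` and `δ - α_j`, of heights `±1`. An
amplitude below `-1` thus means that `β` is negative and not minus a simple root: the wall is not in
a facet of the cube, and it is crossed in the direction of increasing length.
`inv_smul_lift_rho_lt_iff` proves this and the converse.

Elements with equal `g⁻¹ ρ̃` move `p` to points whose finite coordinates differ by multiples of `κ`,
hence coincide within the open cube (`eq_of_inv_smul_lift_rho_eq`). Every admissible `g` is reached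
by induction on length (`InCube.obtainable`). The cube is covered because firing negative
coordinates of one of its points terminates and never leaves the cube
(`exists_inCube_inv_smul_nonneg`).

The Coxeter theory needed (deletion, length criterion, freeness) follows from every affine root
having coefficients of one sign, which rests on `θ` dominating all roots coefficientwise
(`IsLongestRoot.rootCoeff_le`). -/

namespace NumbersGame

/-! ### Heights, simple-root coefficients and the highest root. -/

section RootCoefficients

variable {ι M N : Type*} [AddCommGroup M] [Module ℝ M] [AddCommGroup N] [Module ℝ N]
  {P : RootPairing ι ℝ M N}

theorem isPos_or_isPos_neg (b : P.Base) (α : ι) :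
    b.IsPos α ∨ b.IsPos (P.reflectionPerm α α) :=
  RootPairing.Base.IsPos.or_neg b α

theorem height_neg (b : P.Base) (α : ι) :
    b.height (P.reflectionPerm α α) = -b.height α :=
  b.height_reflectionPerm_self α

theorem IsLongestRoot.height_pos [Nonempty ι] {b : P.Base} {θ : ι}
    (hθ : IsLongestRoot b θ) : 0 < b.height θ := by
  obtain ⟨i, hi⟩ := b.support_nonempty
  have := hθ i
  rw [RootPairing.Base.height_one_of_mem_support hi] at this
  lia

/-- A negative pairing would make `θ + α_i` a root of greater height, unless `θ = -α_i`, whose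
height is negative. -/
theorem IsLongestRoot.pairingIn_nonneg [Finite ι] [P.IsCrystallographic] [Nonempty ι]
    {b : P.Base} {θ : ι} (hθ : IsLongestRoot b θ) (i : b.support) :
    0 ≤ P.pairingIn ℤ θ i := by
  by_contra! h
  have hi : b.height i = 1 := RootPairing.Base.height_one_of_mem_support i.2
  by_cases hn : P.root θ = -P.root i
  · have h1 : θ = P.reflectionPerm (i : ι) i := by
      apply P.root.injective; simp [hn]
    have := height_neg b i
    have := hθ.height_pos
    lia
  · obtain ⟨k, hk⟩ := P.root_add_root_mem_of_pairingIn_neg h hn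
    have := b.height_add hk
    have := hθ k
    lia

/-- A positive root pairs positively with some simple root; if the two differ, their difference is a
root, here of the impossible height `0`. -/
theorem mem_support_of_height_eq_one [Finite ι] [P.IsCrystallographic] {b : P.Base} {α : ι}
    (h : b.height α = 1) : α ∈ b.support := by
  have hpos : b.IsPos α := by rw [b.isPos_iff, h]; exact one_pos
  obtain ⟨j, hj, hlt⟩ := hpos.exists_mem_support_pos_pairingIn
  by_cases hjα : α = j
  · rwa [hjα]
  · obtain ⟨γ, hγ⟩ :=
      P.root_sub_root_mem_of_pairingIn_pos ((P.zero_lt_pairingIn_iff' ℤ).mp hlt) hjα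
    have := b.height_sub hγ
    rw [h, RootPairing.Base.height_one_of_mem_support hj, sub_self] at this
    exact absurd this (b.height_ne_zero γ)

variable [P.IsRootSystem]

/-- The coefficient of the simple root `α_i` in the root `α`. -/
noncomputable def rootCoeff (b : P.Base) (α : ι) (i : b.support) : ℝ :=
  b.toWeightBasis.repr (P.root α) i

theorem sum_rootCoeff_smul (b : P.Base) (α : ι) :
    ∑ i, rootCoeff b α i • P.root i = P.root α := by
  simpa [rootCoeff] using b.toWeightBasis.sum_repr (P.root α)

theorem rootCoeff_eq_of_root_eq_sum {b : P.Base} {α : ι} {f : ι → ℤ}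
    (h : P.root α = ∑ j ∈ b.support, f j • P.root j) (i : b.support) :
    rootCoeff b α i = f i := by
  have : P.root α = ∑ j : b.support, (f j : ℝ) • b.toWeightBasis j := by
    rw [h, ← Finset.sum_coe_sort b.support]
    simp [Int.cast_smul_eq_zsmul]
  rw [rootCoeff, this, Module.Basis.repr_sum_self]

theorem sum_rootCoeff (b : P.Base) (α : ι) : ∑ i, rootCoeff b α i = b.height α := by
  obtain ⟨f, -, -, hf⟩ := b.exists_root_eq_sum_int α
  simp_rw [RootPairing.Base.height_eq_sum hf, rootCoeff_eq_of_root_eq_sum hf]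
  rw [Finset.sum_coe_sort b.support (fun i => (f i : ℝ))]
  push_cast
  rfl

theorem rootCoeff_nonneg {b : P.Base} {α : ι} (h : b.IsPos α) (i : b.support) :
    0 ≤ rootCoeff b α i := by
  obtain ⟨f, -, hf₁, hf⟩ := b.exists_root_eq_sum_int α
  rw [rootCoeff_eq_of_root_eq_sum hf]
  rcases hf₁ with h₁ | h₁
  · exact_mod_cast h₁.le i
  · rw [b.isPos_iff, RootPairing.Base.height_eq_sum hf] at h
    exact absurd h (not_lt.mpr (Finset.sum_nonpos fun j _ => h₁.le j))

theorem rootCoeff_reflectionPerm_self (b : P.Base) (α : ι) (i : b.support) :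
    rootCoeff b (P.reflectionPerm α α) i = -rootCoeff b α i := by
  simp [rootCoeff]

theorem rootCoeff_of_add {b : P.Base} {α β γ : ι} (h : P.root γ = P.root α + P.root β)
    (i : b.support) : rootCoeff b γ i = rootCoeff b α i + rootCoeff b β i := by
  simp [rootCoeff, h]

theorem rootCoeff_simple (b : P.Base) [DecidableEq b.support] (j : b.support) :
    rootCoeff b j = Pi.single j 1 := by
  ext i
  simp [rootCoeff, Finsupp.single_apply, Pi.single_apply, eq_comm]

theorem sum_rootCoeff_mul_pairing (b : P.Base) (α β : ι) :
    ∑ i, rootCoeff b α i * P.pairing i β = P.pairing α β := by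
  rw [← P.root_coroot'_eq_pairing β α, ← sum_rootCoeff_smul b α, map_sum]
  simp

theorem sum_rootCoeff_mul_pairingIn [P.IsCrystallographic] (b : P.Base) (α β : ι) :
    ∑ i, rootCoeff b α i * (P.pairingIn ℤ i β : ℝ) = P.pairingIn ℤ α β := by
  have h (i j : ι) : (P.pairingIn ℤ i j : ℝ) = P.pairing i j := P.algebraMap_pairingIn ℤ i j
  simp_rw [h]
  exact sum_rootCoeff_mul_pairing b α β

theorem rootCoeff_reflectionPerm [P.IsCrystallographic] (b : P.Base) (α β : ι) (i : b.support) :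
    rootCoeff b (P.reflectionPerm β α) i =
      rootCoeff b α i - P.pairingIn ℤ α β * rootCoeff b β i := by
  have h : (P.pairingIn ℤ α β : ℝ) = P.pairing α β := P.algebraMap_pairingIn ℤ α β
  simp [rootCoeff, h, P.reflection_apply_root]

section HighestRoot

variable [Finite ι] [P.IsCrystallographic] {b : P.Base} {θ : ι}

/-- The simple roots occurring in `θ` span an invariant subspace, which irreducibility forces to be
everything. -/
theorem IsLongestRoot.rootCoeff_pos [P.IsReduced] [P.IsIrreducible] (hθ : IsLongestRoot b θ)
    (i : b.support) : 0 < rootCoeff b θ i := by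
  have : Nonempty ι := ⟨θ⟩
  have hnn := rootCoeff_nonneg (b := b) (α := θ) hθ.height_pos
  by_contra hi
  have hi : rootCoeff b θ i = 0 := le_antisymm (not_lt.mp hi) (hnn i)
  let s : Set b.support := {j | rootCoeff b θ j ≠ 0}
  let q : Submodule ℝ M := Submodule.span ℝ (b.toWeightBasis '' s)
  have hq : ∀ j, q ∈ Module.End.invtSubmodule (P.reflection j) := by
    rw [← b.forall_mem_support_invtSubmodule_iff]
    intro j hj
    by_cases hjs : (⟨j, hj⟩ : b.support) ∈ s
    · apply Submodule.mem_invtSubmodule_reflection_of_mem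
      exact Submodule.subset_span ⟨_, hjs, by simp⟩
    · have hj0 : rootCoeff b θ ⟨j, hj⟩ = 0 := by simpa [s] using hjs
      have hle (k : b.support) : rootCoeff b θ k * (P.pairingIn ℤ k j : ℝ) ≤ 0 := by
        by_cases hk : k = ⟨j, hj⟩
        · simp [hk, hj0]
        · have := b.pairingIn_le_zero_of_ne (fun h => hk (Subtype.ext h)) k.2 hj
          exact mul_nonpos_of_nonneg_of_nonpos (hnn k) (by exact_mod_cast this)
      -- The sum is the pairing of `θ` with `α_j`, which is nonnegative, while every term is
      -- nonpositive. So each `α_k` occurring in `θ` is orthogonal to `α_j`, and the reflection in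
      -- `α_j` fixes `q` pointwise.
      have hsum : ∑ k : b.support, rootCoeff b θ k * (P.pairingIn ℤ k j : ℝ) = 0 := by
        apply le_antisymm (Finset.sum_nonpos fun k _ => hle k)
        rw [sum_rootCoeff_mul_pairingIn]
        exact_mod_cast hθ.pairingIn_nonneg ⟨j, hj⟩
      rw [Finset.sum_eq_zero_iff_of_nonpos (fun k _ => hle k)] at hsum
      have hfix : ∀ x ∈ q, P.reflection j x = x := by
        intro x hx
        induction hx using Submodule.span_induction with
        | mem x hx =>
          obtain ⟨k, hk, rfl⟩ := hx
          have h0 : P.pairingIn ℤ k j = 0 := by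
            have := hsum k (Finset.mem_univ k)
            rcases mul_eq_zero.mp this with h | h
            · exact absurd h hk
            · exact_mod_cast h
          have h0 : P.pairing k j = 0 := by rw [← P.algebraMap_pairingIn ℤ, h0, map_zero]
          simp [P.reflection_apply_root, h0]
        | zero => simp
        | add x y _ _ hx hy => rw [map_add, hx, hy]
        | smul c x _ hx => rw [map_smul, hx]
      intro x hx
      change P.reflection j x ∈ q
      rwa [hfix x hx]
  have hs : s.Nonempty := by
    by_contra h
    rw [Set.not_nonempty_iff_eq_empty] at h
    have h0 (k : b.support) : rootCoeff b θ k = 0 := by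
      by_contra hk
      exact (h ▸ (show k ∈ s from hk) : k ∈ (∅ : Set b.support))
    have := sum_rootCoeff b θ
    simp only [h0, Finset.sum_const_zero] at this
    have h1 : b.height θ = 0 := by exact_mod_cast this.symm
    have := hθ.height_pos
    lia
  have hqb : q ≠ ⊥ := by
    obtain ⟨k, hk⟩ := hs
    intro h
    have : b.toWeightBasis k ∈ q := Submodule.subset_span ⟨k, hk, rfl⟩
    rw [h, Submodule.mem_bot] at this
    exact b.toWeightBasis.ne_zero k this
  have htop := RootPairing.IsIrreducible.eq_top_of_invtSubmodule_reflection (P := P) q hq hqb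
  have hmem : b.toWeightBasis i ∈ q := htop ▸ Submodule.mem_top
  exact (b.toWeightBasis.self_mem_span_image.mp hmem) hi

/-- Climb from `α` by adding simple roots that pair negatively with it. When none is left, `α` is
dominant, so it pairs positively with `θ`, all of whose coefficients are positive; then `θ - α` is
zero or a positive root. -/
theorem IsLongestRoot.rootCoeff_le [P.IsReduced] [P.IsIrreducible] (hθ : IsLongestRoot b θ)
    (α : ι) (i : b.support) : rootCoeff b α i ≤ rootCoeff b θ i := by
  have : Nonempty ι := ⟨θ⟩
  have hnn := rootCoeff_nonneg (b := b) (α := θ) hθ.height_pos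
  generalize hn : (b.height θ - b.height α).toNat = n
  induction n using Nat.strong_induction_on generalizing α with
  | _ n ih =>
  by_cases hex : ∃ j : b.support, P.pairingIn ℤ α j < 0
  · obtain ⟨j, hj⟩ := hex
    have hj1 : b.height j = 1 := RootPairing.Base.height_one_of_mem_support j.2
    have hjn := rootCoeff_nonneg (RootPairing.Base.isPos_of_mem_support j.2) i
    by_cases hα : P.root α = -P.root j
    · have h1 : rootCoeff b α i = - rootCoeff b j i := by simp [rootCoeff, hα]
      linarith [hnn i]
    · obtain ⟨γ, hγ⟩ := P.root_add_root_mem_of_pairingIn_neg hj hα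
      have h1 := b.height_add hγ
      have h2 := hθ γ
      have := ih _ (by lia) γ rfl
      rw [rootCoeff_of_add hγ] at this
      linarith
  · push Not at hex
    have hpos : 0 < P.pairingIn ℤ θ α := by
      have h1 (j : b.support) : 0 ≤ rootCoeff b θ j * (P.pairingIn ℤ j α : ℝ) := by
        refine mul_nonneg (hnn j) ?_
        have : ¬ P.pairingIn ℤ j α < 0 := by
          rw [P.pairingIn_lt_zero_iff ℤ]
          exact not_lt.mpr (hex j)
        exact_mod_cast not_lt.mp this
      obtain ⟨j, hj, hj0⟩ := b.exists_mem_support_pos_pairingIn_ne_zero α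
      have h2 : 0 < ∑ j : b.support, rootCoeff b θ j * (P.pairingIn ℤ j α : ℝ) := by
        refine Finset.sum_pos' (fun j _ => h1 j) ⟨⟨j, hj⟩, Finset.mem_univ _, ?_⟩
        refine lt_of_le_of_ne (h1 _) (Ne.symm ?_)
        exact mul_ne_zero (hθ.rootCoeff_pos _).ne' (by exact_mod_cast hj0)
      rw [sum_rootCoeff_mul_pairingIn] at h2
      exact_mod_cast h2
    by_cases hαθ : θ = α
    · rw [hαθ]
    · obtain ⟨γ, hγ⟩ := P.root_sub_root_mem_of_pairingIn_pos hpos hαθ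
      have h1 := b.height_sub hγ
      have h2 := hθ α
      have h3 := rootCoeff_nonneg (b.isPos_iff'.mpr (by lia : 0 ≤ b.height γ)) i
      have h4 : rootCoeff b γ i = rootCoeff b θ i - rootCoeff b α i := by
        simp [rootCoeff, hγ]
      linarith

end HighestRoot

end RootCoefficients

/-! ### Words and lengths in the reflection group. -/

section Words

variable {I : Type*} (C : Matrix I I ℤ)

theorem simpleReflection_smul (i : I) (v : I → ℝ) : simpleReflection C i • v = fire C i v := rfl

theorem simpleReflection_mul_self (i : I) : simpleReflection C i * simpleReflection C i = 1 := by
  apply Subtype.ext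
  apply LinearEquiv.ext
  exact fireFun_fireFun C i

theorem simpleReflection_inv (i : I) : (simpleReflection C i)⁻¹ = simpleReflection C i :=
  inv_eq_of_mul_eq_one_left (simpleReflection_mul_self C i)

theorem mul_simpleReflection_inv_smul (g : weylGroup C) (i : I) (v : I → ℝ) :
    (g * simpleReflection C i)⁻¹ • v = fire C i (g⁻¹ • v) := by
  rw [mul_inv_rev, simpleReflection_inv, mul_smul, simpleReflection_smul]

theorem fire_self (i : I) (v : I → ℝ) : fire C i v i = -v i := by
  simp [fire, fireFun]

theorem exists_word (g : weylGroup C) :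
    ∃ word : List I, (word.map (simpleReflection C)).prod = g := by
  obtain ⟨g, hg⟩ := g
  induction hg using Subgroup.closure_induction with
  | mem x hx =>
    obtain ⟨i, rfl⟩ := hx
    exact ⟨[i], by simp; rfl⟩
  | one => exact ⟨[], rfl⟩
  | mul x y hx hy ihx ihy =>
    obtain ⟨w₁, h₁⟩ := ihx
    obtain ⟨w₂, h₂⟩ := ihy
    exact ⟨w₁ ++ w₂, by rw [List.map_append, List.prod_append, h₁, h₂]; rfl⟩
  | inv x hx ih =>
    obtain ⟨w, h⟩ := ih
    refine ⟨w.reverse, ?_⟩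
    have : (⟨x⁻¹, inv_mem hx⟩ : weylGroup C) = (⟨x, hx⟩ : weylGroup C)⁻¹ := rfl
    rw [this, ← h, List.prod_inv_reverse, List.map_reverse, List.map_map]
    congr 3

theorem exists_word_length_eq (g : weylGroup C) :
    ∃ word : List I, word.length = length C g ∧ (word.map (simpleReflection C)).prod = g := by
  have h : {n | ∃ word : List I, word.length = n ∧
      (word.map (simpleReflection C)).prod = g}.Nonempty := by
    obtain ⟨w, hw⟩ := exists_word C g
    exact ⟨_, w, rfl, hw⟩
  exact Nat.sInf_mem h

theorem length_le (word : List I) :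
    length C (word.map (simpleReflection C)).prod ≤ word.length :=
  Nat.sInf_le ⟨word, rfl, rfl⟩

theorem exists_length_mul_lt {g : weylGroup C} (hg : g ≠ 1) :
    ∃ i, length C (g * simpleReflection C i) < length C g := by
  obtain ⟨w, hw, rfl⟩ := exists_word_length_eq C g
  rcases w.eq_nil_or_concat with rfl | ⟨w', i, rfl⟩
  · exact absurd rfl hg
  · refine ⟨i, ?_⟩
    rw [← hw]
    simp only [List.concat_eq_append, List.map_append, List.prod_append, List.map_cons,
      List.map_nil, List.prod_singleton, mul_assoc, simpleReflection_mul_self, mul_one]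
    exact (length_le C w').trans_lt (by simp)

variable {C}

theorem weylGroup_induction {p : weylGroup C → Prop} (g : weylGroup C) (one : p 1)
    (mul : ∀ i g, p g → p (simpleReflection C i * g)) : p g := by
  obtain ⟨w, rfl⟩ := exists_word C g
  induction w with
  | nil => exact one
  | cons i w ih => simpa using mul i _ ih

end Words

/-! ### Affine roots, their reflections and the group action on them. -/

section AffineRoots

variable {ι M N : Type*} [AddCommGroup M] [Module ℝ M] [AddCommGroup N] [Module ℝ N]
  {P : RootPairing ι ℝ M N}

section Coroots

variable [P.IsCrystallographic] (b : P.Base) (θ : ι)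

/-- The amplitudes of the coroot of `α`. -/
noncomputable def corootVec (α : ι) : Option b.support → ℝ := fun j =>
  P.pairingIn ℤ (simpleRootIndex b θ j) α

theorem corootVec_reflectionPerm (γ α : ι) : corootVec b θ (P.reflectionPerm γ α) =
    corootVec b θ α - (P.pairingIn ℤ γ α : ℝ) • corootVec b θ γ := by
  funext j
  have (i j : ι) : (P.pairingIn ℤ i j : ℝ) = P.pairing i j := P.algebraMap_pairingIn ℤ i j
  simp only [corootVec, this, Pi.sub_apply, Pi.smul_apply, smul_eq_mul]
  rw [← P.root_coroot_eq_pairing, P.coroot_reflectionPerm, P.coreflection_apply_coroot]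
  simp

end Coroots

variable [P.IsRootSystem] (b : P.Base) (θ : ι)

/-- The coefficients of the affine root `α + k δ`, for `a = (α, k)`, in the affine simple roots. -/
noncomputable def affCoeff (a : ι × ℤ) : Option b.support → ℝ
  | none => a.2
  | some i => rootCoeff b a.1 i + a.2 * rootCoeff b θ i

/-- The value of the affine root `a` at the configuration `v`. -/
noncomputable def affEval (a : ι × ℤ) (v : Option b.support → ℝ) : ℝ := affCoeff b θ a ⬝ᵥ v

/-- The affine simple root of the vertex `i`. -/
def simpleAff (i : Option b.support) : ι × ℤ :=
  (simpleRootIndex b θ i, if i = none then 1 else 0)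

theorem affEval_eq (a : ι × ℤ) (v : Option b.support → ℝ) :
    affEval b θ a v = ∑ i, rootCoeff b a.1 i * v (some i) + a.2 * (delta b θ ⬝ᵥ v) := by
  simp only [affEval, dotProduct, Fintype.sum_option, affCoeff, delta, rootCoeff]
  rw [mul_add, Finset.mul_sum, add_left_comm, ← Finset.sum_add_distrib]
  simp [add_mul, mul_assoc]

theorem affCoeff_simpleAff [DecidableEq (Option b.support)] (i : Option b.support) :
    affCoeff b θ (simpleAff b θ i) = Pi.single i 1 := by
  classical
  funext j
  cases i <;> cases j <;>
    simp [affCoeff, simpleAff, simpleRootIndex, rootCoeff_reflectionPerm_self, rootCoeff_simple,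
      Pi.single_apply]

theorem affEval_simpleAff (i : Option b.support) (v : Option b.support → ℝ) :
    affEval b θ (simpleAff b θ i) v = v i := by
  classical
  simp [affEval, affCoeff_simpleAff]

theorem affCoeff_injective : Function.Injective (affCoeff b θ) := by
  rintro ⟨α, k⟩ ⟨β, l⟩ h
  have h1 : k = l := by simpa [affCoeff] using congrFun h none
  subst h1
  have h2 : P.root α = P.root β := by
    rw [← sum_rootCoeff_smul b α, ← sum_rootCoeff_smul b β]
    refine Finset.sum_congr rfl fun i _ => ?_
    have := congrFun h (some i)
    simp only [affCoeff, add_left_inj] at this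
    rw [this]
  rw [P.root.injective h2]

theorem affEval_ext {a c : ι × ℤ} (h : ∀ v, affEval b θ a v = affEval b θ c v) : a = c := by
  classical
  apply affCoeff_injective b θ
  funext j
  simpa [affEval] using h (Pi.single j 1)

theorem affCoeff_ne_zero (a : ι × ℤ) : affCoeff b θ a ≠ 0 := by
  intro h
  have h1 : a.2 = 0 := by simpa [affCoeff] using congrFun h none
  apply P.ne_zero a.1
  rw [← sum_rootCoeff_smul b a.1]
  refine Finset.sum_eq_zero fun i _ => ?_
  have : rootCoeff b a.1 i = 0 := by simpa [affCoeff, h1] using congrFun h (some i)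
  rw [this, zero_smul]

theorem affEval_sub (a : ι × ℤ) (v w : Option b.support → ℝ) :
    affEval b θ a (v - w) = affEval b θ a v - affEval b θ a w := dotProduct_sub _ _ _

theorem affEval_smul (a : ι × ℤ) (c : ℝ) (v : Option b.support → ℝ) :
    affEval b θ a (c • v) = c * affEval b θ a v := dotProduct_smul _ _ _

variable [P.IsCrystallographic]

/-- The reflection in the affine root `a`. -/
noncomputable def affReflect (a : ι × ℤ) (v : Option b.support → ℝ) : Option b.support → ℝ :=
  v - affEval b θ a v • corootVec b θ a.1

/-- The permutation of the affine roots by the reflection in the affine root `c`. -/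
noncomputable def affPerm (c a : ι × ℤ) : ι × ℤ :=
  (P.reflectionPerm c.1 a.1, a.2 - P.pairingIn ℤ a.1 c.1 * c.2)

theorem fire_eq_affReflect (i : Option b.support) (v : Option b.support → ℝ) :
    fire (affineCartan b θ) i v = affReflect b θ (simpleAff b θ i) v := by
  funext j
  simp only [affReflect, affEval_simpleAff, Pi.sub_apply, Pi.smul_apply, smul_eq_mul]
  by_cases h : j = i
  · subst h
    have : P.pairingIn ℤ (simpleRootIndex b θ j) (simpleRootIndex b θ j) = 2 := by simp
    simp only [fire_self, corootVec, simpleAff, this]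
    push_cast
    ring
  · simp [fire, fireFun, h, affineCartan, corootVec, simpleAff, mul_comm]

/-- The finite vertices contribute the pairing of `θ`, the extending vertex that of `-θ`. Hence
reflections preserve each `H_κ`. -/
theorem delta_corootVec (α : ι) : delta b θ ⬝ᵥ corootVec b θ α = 0 := by
  have h := sum_rootCoeff_mul_pairingIn b θ α
  simp only [rootCoeff] at h
  simp only [dotProduct, Fintype.sum_option, delta, corootVec, simpleRootIndex, h]
  simp

theorem affEval_corootVec (a : ι × ℤ) (α : ι) :
    affEval b θ a (corootVec b θ α) = P.pairingIn ℤ a.1 α := by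
  rw [affEval_eq, delta_corootVec, mul_zero, add_zero]
  exact sum_rootCoeff_mul_pairingIn b a.1 α

theorem delta_affReflect (a : ι × ℤ) (v : Option b.support → ℝ) :
    delta b θ ⬝ᵥ affReflect b θ a v = delta b θ ⬝ᵥ v := by
  simp [affReflect, dotProduct_sub, dotProduct_smul, delta_corootVec]

theorem affCoeff_affPerm (c a : ι × ℤ) : affCoeff b θ (affPerm (P := P) c a) =
    affCoeff b θ a - (P.pairingIn ℤ a.1 c.1 : ℝ) • affCoeff b θ c := by
  funext j
  cases j <;> simp [affCoeff, affPerm, rootCoeff_reflectionPerm]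
  ring

theorem affEval_affPerm (c a : ι × ℤ) (v : Option b.support → ℝ) :
    affEval b θ (affPerm (P := P) c a) v = affEval b θ a (affReflect b θ c v) := by
  rw [affReflect, affEval_sub, affEval_smul, affEval_corootVec, affEval, affCoeff_affPerm,
    sub_dotProduct, smul_dotProduct, smul_eq_mul, mul_comm]
  rfl

theorem affReflect_affReflect (c : ι × ℤ) (v : Option b.support → ℝ) :
    affReflect b θ c (affReflect b θ c v) = v := by
  have h : affEval b θ c (affReflect b θ c v) = -affEval b θ c v := by
    rw [affReflect, affEval_sub, affEval_smul, affEval_corootVec]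
    simp
    ring
  rw [affReflect, h, affReflect]
  simp

theorem affReflect_conj (c a : ι × ℤ) (v : Option b.support → ℝ) :
    affReflect b θ c (affReflect b θ a v) =
      affReflect b θ (affPerm (P := P) c a) (affReflect b θ c v) := by
  have h : affEval b θ (affPerm (P := P) c a) (affReflect b θ c v) = affEval b θ a v := by
    rw [affEval_affPerm, affReflect_affReflect]
  have h2 : affEval b θ c (affReflect b θ a v) =
      affEval b θ c v - affEval b θ a v * P.pairingIn ℤ c.1 a.1 := by
    rw [affReflect, affEval_sub, affEval_smul, affEval_corootVec]
  rw [affReflect.eq_def b θ (affPerm c a), h, affReflect.eq_def b θ c (affReflect b θ a v), h2]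
  simp only [affPerm, corootVec_reflectionPerm, affReflect]
  module

/-- The Weyl group permutes the affine roots and the corresponding reflections. -/
theorem exists_affRoot_image (g : weylGroup (affineCartan b θ)) (a : ι × ℤ) :
    ∃ a' : ι × ℤ, (∀ v, affEval b θ a' (g • v) = affEval b θ a v) ∧
      ∀ v, g • affReflect b θ a v = affReflect b θ a' (g • v) := by
  induction g using weylGroup_induction with
  | one => exact ⟨a, by simp, by simp⟩
  | mul i g ih =>
    obtain ⟨a', h₁, h₂⟩ := ih
    refine ⟨affPerm (P := P) (simpleAff b θ i) a', fun v => ?_, fun v => ?_⟩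
    · rw [mul_smul, simpleReflection_smul, fire_eq_affReflect, affEval_affPerm,
        affReflect_affReflect, h₁]
    · rw [mul_smul, mul_smul, h₂, simpleReflection_smul, simpleReflection_smul,
        fire_eq_affReflect, fire_eq_affReflect, affReflect_conj]

theorem exists_affEval_smul (g : weylGroup (affineCartan b θ)) (a : ι × ℤ) :
    ∃ a' : ι × ℤ, ∀ v, affEval b θ a' v = affEval b θ a (g • v) := by
  obtain ⟨a', h, -⟩ := exists_affRoot_image b θ g⁻¹ a
  exact ⟨a', fun v => by rw [← h, inv_smul_smul]⟩

/-- The root is `g α_i`; it vanishes on the wall separating `g C_e` from `g s_i C_e`. -/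
theorem exists_affEval_eq_inv_smul (g : weylGroup (affineCartan b θ)) (i : Option b.support) :
    ∃ a : ι × ℤ, ∀ v, affEval b θ a v = (g⁻¹ • v) i := by
  obtain ⟨a, h⟩ := exists_affEval_smul b θ g⁻¹ (simpleAff b θ i)
  exact ⟨a, fun v => by rw [h, affEval_simpleAff]⟩

/-- The hypothesis says `g α_i = α_j`, so conjugation by `g` carries `s_i` to `s_j`. -/
theorem smul_fire_of_inv_smul_eq {g : weylGroup (affineCartan b θ)} {i j : Option b.support}
    (h : ∀ v : Option b.support → ℝ, (g⁻¹ • v) i = v j) :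
    simpleReflection (affineCartan b θ) j * g = g * simpleReflection (affineCartan b θ) i := by
  obtain ⟨a, h₁, h₂⟩ := exists_affRoot_image b θ g (simpleAff b θ i)
  have ha : a = simpleAff b θ j := affEval_ext b θ fun v => by
    have := h₁ (g⁻¹ • v)
    rw [smul_inv_smul, affEval_simpleAff, h] at this
    rw [this, affEval_simpleAff]
  subst ha
  apply Subtype.ext
  apply LinearEquiv.ext
  intro v
  have := h₂ v
  rw [← fire_eq_affReflect, ← fire_eq_affReflect] at this
  exact this.symm

theorem delta_smul (g : weylGroup (affineCartan b θ)) (v : Option b.support → ℝ) :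
    delta b θ ⬝ᵥ (g • v) = delta b θ ⬝ᵥ v := by
  induction g using weylGroup_induction with
  | one => simp
  | mul i g ih =>
    rw [mul_smul, simpleReflection_smul, fire_eq_affReflect, delta_affReflect, ih]

end AffineRoots

/-! ### Sign dichotomy for affine roots, lengths and freeness of the action. -/

section Positivity

variable {ι M N : Type*} [AddCommGroup M] [Module ℝ M] [AddCommGroup N] [Module ℝ N]
  {P : RootPairing ι ℝ M N} [P.IsRootSystem] [Finite ι] [P.IsCrystallographic]
  [P.IsReduced] [P.IsIrreducible] {b : P.Base} {θ : ι}

theorem IsLongestRoot.neg_rootCoeff_le (hθ : IsLongestRoot b θ) (α : ι) (i : b.support) :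
    -rootCoeff b θ i ≤ rootCoeff b α i := by
  have := hθ.rootCoeff_le (P.reflectionPerm α α) i
  rw [rootCoeff_reflectionPerm_self] at this
  linarith

theorem affCoeff_nonneg (hθ : IsLongestRoot b θ) {a : ι × ℤ} (h : 0 < a.2) :
    0 ≤ affCoeff b θ a := by
  have h1 : (1 : ℝ) ≤ a.2 := by exact_mod_cast h
  intro j
  cases j with
  | none => simp only [affCoeff, Pi.zero_apply]; linarith
  | some i =>
    simp only [affCoeff, Pi.zero_apply]
    nlinarith [hθ.neg_rootCoeff_le a.1 i, hθ.rootCoeff_pos i]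

theorem affCoeff_nonpos (hθ : IsLongestRoot b θ) {a : ι × ℤ} (h : a.2 < 0) :
    affCoeff b θ a ≤ 0 := by
  have h1 : (a.2 : ℝ) ≤ -1 := by exact_mod_cast Int.le_sub_one_of_lt h
  intro j
  cases j with
  | none => simp only [affCoeff, Pi.zero_apply]; linarith
  | some i =>
    simp only [affCoeff, Pi.zero_apply]
    nlinarith [hθ.rootCoeff_le a.1 i, hθ.rootCoeff_pos i]

theorem affCoeff_nonneg_or_nonpos (hθ : IsLongestRoot b θ) (a : ι × ℤ) :
    0 ≤ affCoeff b θ a ∨ affCoeff b θ a ≤ 0 := by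
  rcases lt_trichotomy a.2 0 with h | h | h
  · exact Or.inr (affCoeff_nonpos hθ h)
  · rcases isPos_or_isPos_neg b a.1 with hp | hp
    · left
      intro j
      cases j with
      | none => simp [affCoeff, h]
      | some i => simpa [affCoeff, h] using rootCoeff_nonneg hp i
    · right
      intro j
      cases j with
      | none => simp [affCoeff, h]
      | some i =>
        have := rootCoeff_nonneg hp i
        rw [rootCoeff_reflectionPerm_self] at this
        simpa [affCoeff, h] using this
  · exact Or.inl (affCoeff_nonneg hθ h)

/-- Because all coefficients of a root have one sign, a single interior point `p` detects it. -/
theorem affEval_pos_iff (hθ : IsLongestRoot b θ) {p : Option b.support → ℝ} (hp : ∀ j, 0 < p j)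
    (a : ι × ℤ) : 0 < affEval b θ a p ↔ 0 ≤ affCoeff b θ a := by
  have key : 0 ≤ affCoeff b θ a → 0 < affEval b θ a p := by
    intro h
    obtain ⟨j, hj⟩ := Function.ne_iff.mp (affCoeff_ne_zero b θ a)
    exact Finset.sum_pos' (fun j _ => mul_nonneg (h j) (hp j).le)
      ⟨j, Finset.mem_univ j, mul_pos (lt_of_le_of_ne (h j) (Ne.symm hj)) (hp j)⟩
  refine ⟨fun h => (affCoeff_nonneg_or_nonpos hθ a).resolve_right fun hn => ?_, key⟩
  exact absurd h (not_lt.mpr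
    (Finset.sum_nonpos fun j _ => mul_nonpos_of_nonpos_of_nonneg (hn j) (hp j).le))

theorem affEval_neg_iff (hθ : IsLongestRoot b θ) {p : Option b.support → ℝ} (hp : ∀ j, 0 < p j)
    (a : ι × ℤ) : affEval b θ a p < 0 ↔ affCoeff b θ a ≤ 0 := by
  have key : affCoeff b θ a ≤ 0 → affEval b θ a p < 0 := by
    intro h
    obtain ⟨j, hj⟩ := Function.ne_iff.mp (affCoeff_ne_zero b θ a)
    exact Finset.sum_neg' (fun j _ => mul_nonpos_of_nonpos_of_nonneg (h j) (hp j).le)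
      ⟨j, Finset.mem_univ j, mul_neg_of_neg_of_pos (lt_of_le_of_ne (h j) hj) (hp j)⟩
  refine ⟨fun h => (affCoeff_nonneg_or_nonpos hθ a).resolve_left fun hn => ?_, key⟩
  exact absurd h (not_lt.mpr (Finset.sum_nonneg fun j _ => mul_nonneg (hn j) (hp j).le))

theorem affEval_ne_zero (hθ : IsLongestRoot b θ) {p : Option b.support → ℝ} (hp : ∀ j, 0 < p j)
    (a : ι × ℤ) : affEval b θ a p ≠ 0 := by
  rcases affCoeff_nonneg_or_nonpos hθ a with h | h
  · exact ((affEval_pos_iff hθ hp a).mpr h).ne'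
  · exact ((affEval_neg_iff hθ hp a).mpr h).ne

theorem affEval_smul_ne_zero (hθ : IsLongestRoot b θ) {p : Option b.support → ℝ}
    (hp : ∀ j, 0 < p j) (g : weylGroup (affineCartan b θ)) (a : ι × ℤ) :
    affEval b θ a (g • p) ≠ 0 := by
  obtain ⟨a', h⟩ := exists_affEval_smul b θ g a
  rw [← h]
  exact affEval_ne_zero hθ hp a'

theorem affEval_nonneg (hθ : IsLongestRoot b θ) {p v : Option b.support → ℝ} (hp : ∀ j, 0 < p j)
    (hv : ∀ j, 0 ≤ v j) {a : ι × ℤ} (h : 0 < affEval b θ a p) : 0 ≤ affEval b θ a v :=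
  Finset.sum_nonneg fun j _ => mul_nonneg ((affEval_pos_iff hθ hp a).mp h j) (hv j)

/-- The only positive affine root which a simple reflection makes negative is the simple one. -/
theorem eq_simpleAff (hθ : IsLongestRoot b θ) {p : Option b.support → ℝ} (hp : ∀ j, 0 < p j)
    {a : ι × ℤ} {i : Option b.support} (h₁ : 0 < affEval b θ a p)
    (h₂ : affEval b θ a (fire (affineCartan b θ) i p) < 0) : a = simpleAff b θ i := by
  classical
  rw [fire_eq_affReflect, ← affEval_affPerm, affEval_neg_iff hθ hp, affCoeff_affPerm] at h₂
  have h₁' := (affEval_pos_iff hθ hp a).mp h₁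
  -- The reflection changes only the `i`-th coefficient, so all the others are both nonnegative and
  -- nonpositive.
  have hz (j) (hj : j ≠ i) : affCoeff b θ a j = 0 := by
    have := h₂ j
    simp only [affCoeff_simpleAff, Pi.sub_apply, Pi.smul_apply, Pi.single_eq_of_ne hj, smul_zero,
      sub_zero] at this
    exact le_antisymm this (h₁' j)
  set n := affCoeff b θ a i with hn
  have hmul : affCoeff b θ a = n • affCoeff b θ (simpleAff b θ i) := by
    funext j
    by_cases hj : j = i
    · subst hj; simp [affCoeff_simpleAff, hn]
    · simp [affCoeff_simpleAff, hz j hj, hj]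
  have hroot : P.root a.1 = n • P.root (simpleRootIndex b θ i) := by
    have h0 := congrFun hmul none
    simp only [affCoeff, Pi.smul_apply, smul_eq_mul] at h0
    rw [← sum_rootCoeff_smul b a.1, ← sum_rootCoeff_smul b (simpleRootIndex b θ i),
      Finset.smul_sum]
    refine Finset.sum_congr rfl fun j _ => ?_
    have hj := congrFun hmul (some j)
    simp only [affCoeff, Pi.smul_apply, smul_eq_mul, simpleAff] at hj h0
    rw [smul_smul]
    congr 1
    rw [h0] at hj
    linear_combination hj
  have hn0 : 0 ≤ n := h₁' i
  -- In a reduced system proportional roots agree up to sign, and `n ≥ 0` excludes `-1`.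
  have hn1 : n = 1 := by
    have hne := P.ne_zero (simpleRootIndex b θ i)
    have hlin : ¬ LinearIndependent ℝ ![P.root a.1, P.root (simpleRootIndex b θ i)] := by
      rw [LinearIndependent.pair_iff]
      intro h
      have := (h 1 (-n) (by rw [hroot]; module)).1
      exact one_ne_zero this
    rw [RootPairing.IsReduced.linearIndependent_iff] at hlin
    push Not at hlin
    by_cases he : a.1 = simpleRootIndex b θ i
    · rw [he] at hroot
      have : (n - 1) • P.root (simpleRootIndex b θ i) = 0 := by
        rw [sub_smul, ← hroot, one_smul, sub_self]
      rcases smul_eq_zero.mp this with h | h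
      · linarith
      · exact absurd h hne
    · have h2 := hlin he
      have : (n + 1) • P.root (simpleRootIndex b θ i) = 0 := by
        rw [add_smul, ← hroot, one_smul, h2, neg_add_cancel]
      rcases smul_eq_zero.mp this with h | h
      · linarith
      · exact absurd h hne
  rw [hn1, one_smul] at hmul
  exact affCoeff_injective b θ hmul

/-- The deletion condition. Reading from the right, the deleted letter `j` is the one at which the
image of `α_i` first turns negative; that image is then `α_j`, so `s_j g = g s_i` for the remaining
tail `g`. -/
theorem exists_word_mul_simpleReflection (hθ : IsLongestRoot b θ) {p : Option b.support → ℝ}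
    (hp : ∀ j, 0 < p j) (i : Option b.support) (word : List (Option b.support))
    (h : ((word.map (simpleReflection (affineCartan b θ))).prod⁻¹ • p) i < 0) :
    ∃ word' : List (Option b.support), word'.length + 1 = word.length ∧
      (word'.map (simpleReflection (affineCartan b θ))).prod =
        (word.map (simpleReflection (affineCartan b θ))).prod *
          simpleReflection (affineCartan b θ) i := by
  induction word with
  | nil => exact absurd h (by simpa using (hp i).le)
  | cons j w ih =>
    rw [List.map_cons, List.prod_cons] at h ⊢
    set g := (w.map (simpleReflection (affineCartan b θ))).prod
    obtain ⟨a, ha⟩ := exists_affEval_eq_inv_smul b θ g i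
    rcases lt_or_gt_of_ne (affEval_ne_zero hθ hp a) with hlt | hgt
    · obtain ⟨w', hw', hw⟩ := ih (by rwa [← ha])
      exact ⟨j :: w', by simp [hw'], by rw [List.map_cons, List.prod_cons, hw, mul_assoc]⟩
    · rw [mul_inv_rev, simpleReflection_inv, mul_smul, simpleReflection_smul, ← ha] at h
      have haj := eq_simpleAff hθ hp hgt h
      subst haj
      refine ⟨w, rfl, ?_⟩
      rw [smul_fire_of_inv_smul_eq b θ (i := i) (j := j) (fun v => by rw [← ha, affEval_simpleAff]),
        mul_assoc, simpleReflection_mul_self, mul_one]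

theorem length_mul_lt (hθ : IsLongestRoot b θ) {p : Option b.support → ℝ} (hp : ∀ j, 0 < p j)
    {g : weylGroup (affineCartan b θ)} {i : Option b.support} (h : (g⁻¹ • p) i < 0) :
    length (affineCartan b θ) (g * simpleReflection (affineCartan b θ) i) <
      length (affineCartan b θ) g := by
  obtain ⟨w, hw, rfl⟩ := exists_word_length_eq (affineCartan b θ) g
  obtain ⟨w', hw', h'⟩ := exists_word_mul_simpleReflection hθ hp i w h
  rw [← hw, ← h']
  exact (length_le _ w').trans_lt (by lia)

theorem inv_smul_ne_zero (hθ : IsLongestRoot b θ) {p : Option b.support → ℝ} (hp : ∀ j, 0 < p j)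
    (g : weylGroup (affineCartan b θ)) (i : Option b.support) : (g⁻¹ • p) i ≠ 0 := by
  obtain ⟨a, ha⟩ := exists_affEval_eq_inv_smul b θ g i
  rw [← ha]
  exact affEval_ne_zero hθ hp a

theorem length_lt_mul_iff (hθ : IsLongestRoot b θ) {p : Option b.support → ℝ} (hp : ∀ j, 0 < p j)
    (g : weylGroup (affineCartan b θ)) (i : Option b.support) :
    length (affineCartan b θ) g <
      length (affineCartan b θ) (g * simpleReflection (affineCartan b θ) i) ↔
    0 < (g⁻¹ • p) i := by
  constructor
  · intro h
    by_contra hn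
    have := length_mul_lt hθ hp (lt_of_le_of_ne (not_lt.mp hn) (inv_smul_ne_zero hθ hp g i))
    lia
  · intro h
    have h1 : ((g * simpleReflection (affineCartan b θ) i)⁻¹ • p) i < 0 := by
      rw [mul_inv_rev, simpleReflection_inv, mul_smul, simpleReflection_smul, fire_self]
      linarith
    have := length_mul_lt hθ hp h1
    rwa [mul_assoc, simpleReflection_mul_self, mul_one] at this

/-- If `g ≠ 1`, some `s_i` shortens `g` on the right, so `g α_i` is a negative root. It would be
nonpositive at `g • p`, where its value is `p i > 0`. -/
theorem eq_one_of_smul_nonneg (hθ : IsLongestRoot b θ) {p : Option b.support → ℝ}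
    (hp : ∀ j, 0 < p j) {g : weylGroup (affineCartan b θ)} (h : ∀ j, 0 ≤ (g • p) j) : g = 1 := by
  by_contra hg
  obtain ⟨i, hi⟩ := exists_length_mul_lt _ hg
  obtain ⟨a, ha⟩ := exists_affEval_eq_inv_smul b θ g i
  rcases lt_or_gt_of_ne (affEval_ne_zero hθ hp a) with hlt | hgt
  · have h1 := ha (g • p)
    rw [inv_smul_smul] at h1
    have h2 : affEval b θ a (g • p) ≤ 0 := Finset.sum_nonpos fun j _ =>
      mul_nonpos_of_nonpos_of_nonneg ((affEval_neg_iff hθ hp a).mp hlt j) (h j)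
    linarith [hp i]
  · rw [ha, ← length_lt_mul_iff hθ hp] at hgt
    lia

theorem eq_of_smul_eq_smul_nonneg (hθ : IsLongestRoot b θ) {p v : Option b.support → ℝ}
    (hp : ∀ j, 0 < p j) (hv : ∀ j, 0 ≤ v j) {g h : weylGroup (affineCartan b θ)}
    (e : g • p = h • v) : g = h := by
  have : h⁻¹ * g = 1 := eq_one_of_smul_nonneg hθ hp fun j => by
    rw [mul_smul, e, inv_smul_smul]
    exact hv j
  exact (inv_mul_eq_one.mp this).symm

end Positivity

/-! ### Comparison of the affine and finite Weyl groups. -/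

section FinitePart

variable {ι M N : Type*} [AddCommGroup M] [Module ℝ M] [AddCommGroup N] [Module ℝ N]
  {P : RootPairing ι ℝ M N}

theorem fire_some [P.IsCrystallographic] (b : P.Base) (θ : ι) (i : b.support)
    (v : Option b.support → ℝ) (j : b.support) :
    fire (affineCartan b θ) (some i) v (some j) =
      fire (finiteCartan b) i (fun k => v (some k)) j := by
  by_cases h : j = i <;>
    simp [fire, fireFun, affineCartan, finiteCartan, simpleRootIndex, h]

theorem exists_affine_extension [P.IsCrystallographic] (b : P.Base) (θ : ι)
    (g : weylGroup (finiteCartan b)) :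
    ∃ g' : weylGroup (affineCartan b θ), ∀ (v : Option b.support → ℝ) (j : b.support),
      (g' • v) (some j) = (g • fun k => v (some k)) j := by
  induction g using weylGroup_induction with
  | one => exact ⟨1, by simp⟩
  | mul i g ih =>
    obtain ⟨g', h⟩ := ih
    refine ⟨simpleReflection _ (some i) * g', fun v j => ?_⟩
    rw [mul_smul, mul_smul, simpleReflection_smul, simpleReflection_smul, fire_some]
    rw [show (fun k => (g' • v) (some k)) = g • fun k => v (some k) from funext (h v)]

variable [P.IsRootSystem] (b : P.Base) (θ : ι)

theorem lift_injective : Function.Injective (lift b θ) := fun _ _ h =>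
  funext fun i => congrFun h (some i)

theorem eq_of_delta_eq {v w : Option b.support → ℝ}
    (h : delta b θ ⬝ᵥ v = delta b θ ⬝ᵥ w) (hs : ∀ i, v (some i) = w (some i)) : v = w := by
  funext j
  cases j with
  | some i => exact hs i
  | none => simpa [dotProduct, Fintype.sum_option, delta, hs] using h

theorem affEval_lift (a : ι × ℤ) (u : b.support → ℝ) :
    affEval b θ a (lift b θ u) = ∑ i, rootCoeff b a.1 i * u i := by
  rw [affEval_eq, delta_dotProduct_lift]
  simp [lift]

variable [P.IsCrystallographic]

/-- The reflection in the root `β` on the configurations of the finite Dynkin graph. -/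
noncomputable def finReflect (β : ι) (u : b.support → ℝ) : b.support → ℝ :=
  u - (∑ i, rootCoeff b β i * u i) • fun j : b.support => (P.pairingIn ℤ j β : ℝ)

theorem affReflect_lift (a : ι × ℤ) (u : b.support → ℝ) :
    affReflect b θ a (lift b θ u) = lift b θ (finReflect b a.1 u) := by
  apply eq_lift
  · rw [delta_affReflect, delta_dotProduct_lift]
  · intro i
    simp [affReflect, finReflect, affEval_lift, corootVec, simpleRootIndex, lift]

theorem finReflect_simple (i : b.support) (u : b.support → ℝ) :
    finReflect b i u = fire (finiteCartan b) i u := by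
  -- The finite reflection does not involve `θ`, so any root may stand in for it; here `i` itself.
  have h := fire_eq_affReflect b (i : ι) (some i) (lift b i u)
  rw [affReflect_lift] at h
  funext j
  have := congrFun h (some j)
  rw [fire_some] at this
  exact this.symm

theorem finReflect_conj (γ β : ι) (u : b.support → ℝ) :
    finReflect b (P.reflectionPerm γ β) u =
      finReflect b γ (finReflect b β (finReflect b γ u)) := by
  have h := affReflect_conj b γ (γ, 0) (β, 0) (affReflect b γ (γ, 0) (lift b γ u))
  rw [affReflect_affReflect] at h
  simp only [affReflect_lift, affPerm] at h
  exact (lift_injective b γ h).symm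

theorem finReflect_neg (β : ι) (u : b.support → ℝ) :
    finReflect b (P.reflectionPerm β β) u = finReflect b β u := by
  funext j
  simp [finReflect, rootCoeff_reflectionPerm_self]

variable [Finite ι]

theorem exists_smul_eq_finReflect [P.IsReduced] (β : ι) :
    ∃ g : weylGroup (finiteCartan b), ∀ u : b.support → ℝ, g • u = finReflect b β u := by
  refine b.induction_reflect β (p := fun β => ∃ g : weylGroup (finiteCartan b),
    ∀ u : b.support → ℝ, g • u = finReflect b β u) ?_ ?_ ?_
  · rintro β ⟨g, hg⟩
    exact ⟨g, fun u => by rw [hg, finReflect_neg]⟩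
  · intro i hi
    exact ⟨simpleReflection _ ⟨i, hi⟩, fun u => (finReflect_simple b ⟨i, hi⟩ u).symm⟩
  · rintro β j ⟨g, hg⟩ hj
    refine ⟨simpleReflection _ ⟨j, hj⟩ * (g * simpleReflection _ ⟨j, hj⟩), fun u => ?_⟩
    rw [mul_smul, mul_smul, simpleReflection_smul, simpleReflection_smul, finReflect_conj, hg,
      ← finReflect_simple, ← finReflect_simple]

/-- The affine Weyl group acts on the configurations `ũ` through the finite Weyl group. -/
theorem exists_finite_restriction [P.IsReduced] (g : weylGroup (affineCartan b θ)) :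
    ∃ g' : weylGroup (finiteCartan b), ∀ u : b.support → ℝ,
      g • lift b θ u = lift b θ (g' • u) := by
  induction g using weylGroup_induction with
  | one => exact ⟨1, by simp⟩
  | mul i g ih =>
    obtain ⟨g', h⟩ := ih
    obtain ⟨r, hr⟩ := exists_smul_eq_finReflect b (simpleRootIndex b θ i)
    refine ⟨r * g', fun u => ?_⟩
    rw [mul_smul, mul_smul, h, simpleReflection_smul, fire_eq_affReflect, affReflect_lift, hr]
    rfl

/-- The inverse turns right multiplication by `s_i`, which crosses a wall, into the firing of `i`.
-/
theorem exists_liftRho_eq [P.IsReduced] (b : P.Base) (θ : ι) (g : weylGroup (affineCartan b θ)) :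
    ∃ g' : weylGroup (finiteCartan b), liftRho b θ g' = g⁻¹ • lift b θ (rho b) := by
  obtain ⟨g', h⟩ := exists_finite_restriction b θ g⁻¹
  exact ⟨g', (h (rho b)).symm⟩

variable {b θ} [P.IsReduced] [P.IsIrreducible]

/-- An affine extension of an element fixing `ρ` fixes the all-ones configuration, since it also
preserves `δ`; this configuration is interior, so the extension is trivial. -/
theorem eq_of_smul_rho_eq (hθ : IsLongestRoot b θ) {g h : weylGroup (finiteCartan b)}
    (e : g • rho b = h • rho b) : g = h := by
  have key : ∀ x : weylGroup (finiteCartan b), x • rho b = rho b → x = 1 := by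
    intro x hx
    obtain ⟨x', hx'⟩ := exists_affine_extension b θ x
    have h1 : x' • (fun _ => 1 : Option b.support → ℝ) = fun _ => 1 := by
      apply eq_of_delta_eq b θ (delta_smul b θ x' _)
      intro i
      rw [hx']
      exact congrFun hx i
    have h2 : x' = 1 :=
      eq_one_of_smul_nonneg hθ (p := fun _ => 1) (fun _ => one_pos) (by simp [h1])
    subst h2
    apply Subtype.ext
    apply LinearEquiv.ext
    intro u
    funext j
    exact (hx' (lift b θ u) j).symm
  have := key (h⁻¹ * g) (by rw [mul_smul, e, inv_smul_smul])
  exact (inv_mul_eq_one.mp this).symm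

end FinitePart

/-! ### Chambers inside the hypercube and the amplitude criterion. -/

section Cube

variable {ι M N : Type*} [AddCommGroup M] [Module ℝ M] [AddCommGroup N] [Module ℝ N]
  {P : RootPairing ι ℝ M N}

/-- The affine roots which define the facets of the unit hypercube. -/
def IsCubeRoot (b : P.Base) (a : ι × ℤ) : Prop :=
  ∃ j : b.support, a = (↑j, 0) ∨ a = (P.reflectionPerm j j, 1)

variable [P.IsRootSystem]

theorem affEval_simple_zero (b : P.Base) (θ : ι) (j : b.support) (v : Option b.support → ℝ) :
    affEval b θ (↑j, 0) v = v (some j) :=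
  affEval_simpleAff b θ (some j) v

theorem affEval_neg_simple_one (b : P.Base) (θ : ι) (j : b.support) (v : Option b.support → ℝ) :
    affEval b θ (P.reflectionPerm j j, 1) v = delta b θ ⬝ᵥ v - v (some j) := by
  have := affEval_simple_zero b θ j v
  rw [affEval_eq] at this ⊢
  simp only [rootCoeff_reflectionPerm_self, neg_mul, Finset.sum_neg_distrib] at this ⊢
  push_cast at this ⊢
  linarith

theorem mem_unitHypercube_iff (b : P.Base) (θ : ι) (κ : ℝ) (v : Option b.support → ℝ) :
    v ∈ unitHypercube b θ κ ↔
      delta b θ ⬝ᵥ v = κ ∧ ∀ a, IsCubeRoot b a → 0 ≤ affEval b θ a v := by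
  constructor
  · rintro ⟨h₁, h₂⟩
    refine ⟨h₁, ?_⟩
    rintro a ⟨j, rfl | rfl⟩
    · rw [affEval_simple_zero]
      exact (h₂ j).1
    · rw [affEval_neg_simple_one, h₁]
      exact sub_nonneg.mpr (h₂ j).2
  · rintro ⟨h₁, h₂⟩
    refine ⟨h₁, fun j => ⟨?_, ?_⟩⟩
    · simpa only [affEval_simple_zero] using h₂ _ ⟨j, Or.inl rfl⟩
    · have := h₂ _ ⟨j, Or.inr rfl⟩
      rw [affEval_neg_simple_one, h₁] at this
      exact sub_nonneg.mp this

theorem affEval_lift_rho (b : P.Base) (θ : ι) (a : ι × ℤ) :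
    affEval b θ a (lift b θ (rho b)) = b.height a.1 := by
  rw [affEval_lift, ← sum_rootCoeff]
  simp [rho]

/-- For each `α`, negativity at `v` bounds `k` above because `κ > 0`, and nonnegative coefficients
bound it below by `0`. -/
theorem finite_negative_affRoots [Finite ι] (b : P.Base) (θ : ι) {κ : ℝ} (hκ : 0 < κ) 
    {v : Option b.support → ℝ}
    (hv : delta b θ ⬝ᵥ v = κ) : {a | 0 ≤ affCoeff b θ a ∧ affEval b θ a v < 0}.Finite := by
  refine (Set.finite_iUnion fun α : ι => (Set.finite_Icc (0 : ℤ)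
    ⌈-(∑ i, rootCoeff b α i * v (some i)) / κ⌉).image (Prod.mk α)).subset ?_
  rintro ⟨α, k⟩ ⟨h₁, h₂⟩
  refine Set.mem_iUnion.mpr ⟨α, k, ⟨?_, ?_⟩, rfl⟩
  · have := h₁ none
    simpa [affCoeff] using this
  · rw [affEval_eq, hv] at h₂
    have : (k : ℝ) < -(∑ i, rootCoeff b α i * v (some i)) / κ := by
      rw [lt_div_iff₀ hκ]
      simp only at h₂
      linarith
    exact_mod_cast this.le.trans (Int.le_ceil _)

variable [P.IsCrystallographic]

theorem affPerm_injective (b : P.Base) (θ : ι) (c : ι × ℤ) :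
    Function.Injective (affPerm (P := P) c) := by
  intro a a' h
  refine affEval_ext b θ fun v => ?_
  rw [← affReflect_affReflect b θ c v, ← affEval_affPerm, h, affEval_affPerm]

/-- The image of the point `p` under `g` is in the interior of the hypercube. -/
def InCube (b : P.Base) (θ : ι) (p : Option b.support → ℝ)
    (g : weylGroup (affineCartan b θ)) : Prop :=
  ∀ a, IsCubeRoot b a → 0 < affEval b θ a (g • p)

variable [Finite ι] [P.IsReduced] [P.IsIrreducible] {b : P.Base} {θ : ι}
  {p : Option b.support → ℝ} {κ : ℝ}

theorem inCube_one (hθ : IsLongestRoot b θ) (hp : ∀ j, 0 < p j) : InCube b θ p 1 := by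
  rintro a ⟨j, rfl | rfl⟩
  · rw [one_smul, affEval_simple_zero]
    exact hp _
  · rw [one_smul, affEval_pos_iff hθ hp]
    exact affCoeff_nonneg hθ one_pos

theorem translate_subset_unitHypercube_iff (hθ : IsLongestRoot b θ) (hp : ∀ j, 0 < p j)
    (hpκ : delta b θ ⬝ᵥ p = κ) (g : weylGroup (affineCartan b θ)) :
    translate (affineCartan b θ) g (dominantChamber b θ κ) ⊆ unitHypercube b θ κ ↔
      InCube b θ p g := by
  constructor
  · intro h a ha
    have hmem : g • p ∈ unitHypercube b θ κ := h ⟨p, ⟨hpκ, fun j => (hp j).le⟩, rfl⟩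
    exact lt_of_le_of_ne (((mem_unitHypercube_iff b θ κ _).mp hmem).2 a ha)
      (affEval_smul_ne_zero hθ hp g a).symm
  · rintro h _ ⟨v, ⟨hv, hv0⟩, rfl⟩
    change g • v ∈ _
    rw [mem_unitHypercube_iff, delta_smul]
    refine ⟨hv, fun a ha => ?_⟩
    obtain ⟨a', ha'⟩ := exists_affEval_smul b θ g a
    rw [← ha']
    exact affEval_nonneg hθ hp hv0 (by rw [ha']; exact h a ha)

/-- Crossing the wall of `a` makes no root negative except `a`, so the cube inequalities survive
unless `a` is one of them. -/
theorem InCube.mul_simpleReflection (hθ : IsLongestRoot b θ) (hp : ∀ j, 0 < p j)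
    {g : weylGroup (affineCartan b θ)} (hg : InCube b θ p g) {i : Option b.support} {a : ι × ℤ}
    (ha : ∀ v, affEval b θ a v = (g⁻¹ • v) i) (hc : ¬ IsCubeRoot b a) :
    InCube b θ p (g * simpleReflection (affineCartan b θ) i) := by
  intro c hcr
  obtain ⟨c', hc'⟩ := exists_affEval_smul b θ g c
  have h₁ : 0 < affEval b θ c' p := by rw [hc']; exact hg c hcr
  refine lt_of_le_of_ne (not_lt.mp fun hlt => hc ?_) (affEval_smul_ne_zero hθ hp _ c).symm
  rw [mul_smul, simpleReflection_smul, ← hc'] at hlt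
  have := eq_simpleAff hθ hp h₁ hlt
  subst this
  have : a = c := affEval_ext b θ fun v => by
    have := hc' (g⁻¹ • v)
    rw [smul_inv_smul, affEval_simpleAff] at this
    rw [ha, this]
  rwa [this]

/-- The reflection injects the new set of positive roots negative at the point into the old one,
missing the simple root of `i`. This makes repeated firing terminate. -/
theorem ncard_negative_affRoots_fire_lt (hθ : IsLongestRoot b θ) (hκ : 0 < κ)
    {v : Option b.support → ℝ} (hv : delta b θ ⬝ᵥ v = κ) {i : Option b.support} (hi : v i < 0) :
    {a | 0 ≤ affCoeff b θ a ∧ affEval b θ a (fire (affineCartan b θ) i v) < 0}.ncard <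
      {a | 0 ≤ affCoeff b θ a ∧ affEval b θ a v < 0}.ncard := by
  classical
  have hfin := finite_negative_affRoots b θ hκ hv
  have hp : ∀ j : Option b.support, (0 : ℝ) < (fun _ => 1 : Option b.support → ℝ) j :=
    fun _ => one_pos
  have hmem : simpleAff b θ i ∈ {a | 0 ≤ affCoeff b θ a ∧ affEval b θ a v < 0} := by
    refine ⟨?_, by rwa [affEval_simpleAff]⟩
    rw [affCoeff_simpleAff]
    exact Pi.single_nonneg.mpr zero_le_one
  refine lt_of_le_of_lt ?_ (Set.ncard_sdiff_singleton_lt_of_mem hmem hfin)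
  refine Set.ncard_le_ncard_of_injOn (affPerm (P := P) (simpleAff b θ i)) ?_
    (affPerm_injective b θ _).injOn (hfin.subset Set.sdiff_subset)
  rintro a ⟨h₁, h₂⟩
  have h₁' := (affEval_pos_iff hθ hp a).mpr h₁
  refine ⟨⟨?_, ?_⟩, fun he => ?_⟩
  · rw [← affEval_pos_iff hθ hp]
    refine lt_of_le_of_ne (not_lt.mp fun hlt => ?_) (affEval_ne_zero hθ hp _).symm
    rw [affEval_affPerm, ← fire_eq_affReflect] at hlt
    have := eq_simpleAff hθ hp h₁' hlt
    subst this
    rw [affEval_simpleAff, fire_self] at h₂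
    linarith
  · rwa [affEval_affPerm, ← fire_eq_affReflect]
  · have he : affPerm (P := P) (simpleAff b θ i) a = simpleAff b θ i := he
    rw [← affReflect_affReflect b θ (simpleAff b θ i) (fun _ => 1), ← affEval_affPerm, he,
      affEval_simpleAff, ← fire_eq_affReflect, fire_self] at h₁'
    norm_num at h₁'

/-- Every point of the hypercube is in a chamber contained in it: fire negative vertices. -/
theorem exists_inCube_inv_smul_nonneg (hθ : IsLongestRoot b θ) (hp : ∀ j, 0 < p j) (hκ : 0 < κ)
    {v : Option b.support → ℝ} (hv : v ∈ unitHypercube b θ κ) :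
    ∃ g : weylGroup (affineCartan b θ), InCube b θ p g ∧ ∀ j, 0 ≤ (g⁻¹ • v) j := by
  rw [mem_unitHypercube_iff] at hv
  suffices ∀ n, ∀ g : weylGroup (affineCartan b θ), InCube b θ p g →
      {a | 0 ≤ affCoeff b θ a ∧ affEval b θ a (g⁻¹ • v) < 0}.ncard = n →
      ∃ g : weylGroup (affineCartan b θ), InCube b θ p g ∧ ∀ j, 0 ≤ (g⁻¹ • v) j from
    this _ 1 (inCube_one hθ hp) rfl
  intro n
  induction n using Nat.strong_induction_on with
  | _ n ih =>
  intro g hg hn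
  by_cases hall : ∀ j, 0 ≤ (g⁻¹ • v) j
  · exact ⟨g, hg, hall⟩
  · push Not at hall
    obtain ⟨i, hi⟩ := hall
    obtain ⟨a, ha⟩ := exists_affEval_eq_inv_smul b θ g i
    have hlt := ncard_negative_affRoots_fire_lt hθ hκ ((delta_smul b θ g⁻¹ v).trans hv.1) hi
    rw [hn, ← simpleReflection_smul, ← mul_smul, ← simpleReflection_inv, ← mul_inv_rev] at hlt
    -- The crossed root is negative at `v`, whereas cube roots are nonnegative there.
    refine ih _ hlt _ (hg.mul_simpleReflection hθ hp ha fun hc => ?_) rfl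
    have := hv.2 a hc
    rw [ha] at this
    linarith

/-- Inside the hypercube, the firings of amplitude `< -1` are the crossings of walls which increase
the length. -/
theorem inv_smul_lift_rho_lt_iff (hθ : IsLongestRoot b θ) (hp : ∀ j, 0 < p j) (hκ : 0 < κ)
    (hpκ : delta b θ ⬝ᵥ p = κ) {g : weylGroup (affineCartan b θ)} (hg : InCube b θ p g)
    (i : Option b.support) :
    (g⁻¹ • lift b θ (rho b)) i < -1 ↔
      InCube b θ p (g * simpleReflection (affineCartan b θ) i) ∧
      length (affineCartan b θ) g <
        length (affineCartan b θ) (g * simpleReflection (affineCartan b θ) i) := by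
  obtain ⟨⟨β, k⟩, ha⟩ := exists_affEval_eq_inv_smul b θ g i
  rw [length_lt_mul_iff hθ hp, ← ha, ← ha, affEval_lift_rho]
  have hsum (v : Option b.support → ℝ) (hv : delta b θ ⬝ᵥ v = κ)
      (hv0 : ∀ j : b.support, 0 ≤ v (some j)) (hβ : b.IsPos β) :
      k * κ ≤ affEval b θ (β, k) v := by
    rw [affEval_eq, hv]
    have : 0 ≤ ∑ j, rootCoeff b β j * v (some j) :=
      Finset.sum_nonneg fun j _ => mul_nonneg (rootCoeff_nonneg hβ j) (hv0 j)
    simpa using this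
  constructor
  · intro h
    have hht : b.height β < -1 := by exact_mod_cast h
    have hneg : b.IsPos (P.reflectionPerm β β) := by
      rw [b.isPos_iff, height_neg]
      lia
    constructor
    · refine hg.mul_simpleReflection hθ hp ha ?_
      rintro ⟨j, h | h⟩
      · have h1 : b.height j = 1 := RootPairing.Base.height_one_of_mem_support j.2
        rw [Prod.mk.injEq] at h
        rw [h.1, h1] at hht
        lia
      · have h1 : b.height j = 1 := RootPairing.Base.height_one_of_mem_support j.2
        rw [Prod.mk.injEq] at h
        rw [h.1, height_neg, h1] at hht
        lia
    -- At `g • p` the root `β + kδ` equals `p i > 0` while `β ≤ 0`, which forces `k > 0`.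
    · rw [affEval_pos_iff hθ hp]
      apply affCoeff_nonneg hθ
      have h1 := ha (g • p)
      rw [inv_smul_smul, affEval_eq, delta_smul, hpκ] at h1
      have h2 : ∑ j, rootCoeff b β j * (g • p) (some j) ≤ 0 := by
        refine Finset.sum_nonpos fun j _ => mul_nonpos_of_nonpos_of_nonneg ?_ ?_
        · have := rootCoeff_nonneg hneg j
          rw [rootCoeff_reflectionPerm_self] at this
          linarith
        · have := hg _ ⟨j, Or.inl rfl⟩
          rw [affEval_simple_zero] at this
          exact this.le
      have h3 : 0 < (k : ℝ) * κ := by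
        have := hp i
        simp only at h1
        linarith
      exact_mod_cast pos_of_mul_pos_left h3 hκ.le
  · rintro ⟨hin, hpos⟩
    -- `y` lies across the wall but still in the open cube. Since `β + kδ` is positive at `p`, `k ≥
    -- 0`; its negativity at `y` then rules out positive `β`, leaving only height `-1` to exclude.
    set y := (g * simpleReflection (affineCartan b θ) i) • p with hy
    have hyv : affEval b θ (β, k) y < 0 := by
      rw [ha, hy, mul_smul, inv_smul_smul, simpleReflection_smul, fire_self]
      linarith [hp i]
    have hyδ : delta b θ ⬝ᵥ y = κ := by rw [hy, delta_smul, hpκ]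
    have hy0 (j : b.support) : 0 < y (some j) := by
      simpa only [affEval_simple_zero] using hin _ ⟨j, Or.inl rfl⟩
    have hk0 : 0 ≤ k := by
      by_contra! hk
      rw [affEval_pos_iff hθ hp] at hpos
      have := hpos none
      simp only [Pi.zero_apply, affCoeff] at this
      have : 0 ≤ k := by exact_mod_cast this
      lia
    have hkr : (0 : ℝ) ≤ k := by exact_mod_cast hk0
    rcases isPos_or_isPos_neg b β with hβ | hβ
    · have := hsum y hyδ (fun j => (hy0 j).le) hβ
      linarith [mul_nonneg hkr hκ.le]
    · rw [b.isPos_iff, height_neg] at hβ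
      suffices b.height β ≠ -1 by
        have : b.height β < -1 := by lia
        exact_mod_cast this
      intro hht
      obtain ⟨j, rfl⟩ : ∃ j : b.support, β = P.reflectionPerm j j := by
        refine ⟨⟨P.reflectionPerm β β, mem_support_of_height_eq_one ?_⟩, ?_⟩
        · rw [height_neg, hht, neg_neg]
        · apply P.root.injective
          rw [P.root_reflectionPerm, P.reflection_apply_self, P.root_reflectionPerm,
            P.reflection_apply_self, neg_neg]
      have h₁ (l : ℤ) (v : Option b.support → ℝ) :
          affEval b θ (P.reflectionPerm (j : ι) j, l) v =
            affEval b θ (P.reflectionPerm (j : ι) j, 1) v + (l - 1) * (delta b θ ⬝ᵥ v) := by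
        rw [affEval_eq, affEval_eq]
        push_cast
        ring
      rw [h₁, hyδ] at hyv
      have h₂ := hin _ ⟨j, Or.inr rfl⟩
      -- Here `β = -α_j`. For `k = 0` the root is negative at `p`; for `k ≥ 1` it is at least `δ -
      -- α_j` at `y`, hence positive.
      rcases hk0.eq_or_lt with rfl | hk1
      · rw [h₁, affEval_neg_simple_one] at hpos
        push_cast at hpos
        linarith [hp (some j)]
      · have h₃ : (0 : ℝ) ≤ k - 1 := by exact_mod_cast Int.sub_nonneg_of_le hk1
        linarith [mul_nonneg h₃ hκ.le]

end Cube

/-! ### Admissible group elements and obtainable configurations. -/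

section Injectivity

variable {ι M N : Type*} [AddCommGroup M] [Module ℝ M] [AddCommGroup N] [Module ℝ N]
  {P : RootPairing ι ℝ M N} [P.IsRootSystem] [P.IsCrystallographic]
  [Finite ι] [P.IsReduced] [P.IsIrreducible] {b : P.Base} {θ : ι}
  {p : Option b.support → ℝ} {κ : ℝ}

theorem eq_of_inv_smul_lift_rho_eq (hθ : IsLongestRoot b θ) (hp : ∀ j, 0 < p j) (hκ : 0 < κ)
    (hpκ : delta b θ ⬝ᵥ p = κ) {g h : weylGroup (affineCartan b θ)} (hg : InCube b θ p g)
    (hh : InCube b θ p h) (e : g⁻¹ • lift b θ (rho b) = h⁻¹ • lift b θ (rho b)) : g = h := by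
  obtain ⟨t, ht⟩ := exists_finite_restriction b θ (h * g⁻¹)
  have ht1 : t = 1 := by
    apply eq_of_smul_rho_eq hθ
    apply lift_injective b θ
    rw [← ht, mul_smul, e, smul_inv_smul, one_smul]
  subst ht1
  refine eq_of_smul_eq_smul_nonneg hθ hp (fun j => (hp j).le) (eq_of_delta_eq b θ ?_ fun j => ?_)
  · rw [delta_smul, delta_smul]
  obtain ⟨⟨α, k⟩, ha⟩ := exists_affEval_smul b θ (h * g⁻¹) (↑j, 0)
  -- `h g⁻¹` is trivial at level zero, so it alters `α_j` only by a multiple `kδ`: it translates the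
  -- `j`-th coordinate by `kκ`. Two values in the open interval `(0, κ)` leave only `k = 0`.
  have hα : (α, (0 : ℤ)) = (↑j, 0) := by
    refine affEval_ext b θ fun v => ?_
    have h1 := ha (lift b θ fun i => v (some i))
    rw [ht, one_smul, affEval_lift, affEval_lift] at h1
    rw [affEval_eq, affEval_eq]
    simpa using h1
  obtain rfl : α = j := (Prod.mk.inj hα).1
  have h1 := ha (g • p)
  rw [mul_smul, inv_smul_smul, affEval_simple_zero, affEval_eq, delta_smul, hpκ] at h1
  have h2 : ∑ i, rootCoeff b j i * (g • p) (some i) = (g • p) (some j) := by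
    have := affEval_simple_zero b θ j (g • p)
    rw [affEval_eq] at this
    simpa using this
  simp only at h1
  rw [h2] at h1
  have g1 := hg _ ⟨j, Or.inl rfl⟩
  have g2 := hg _ ⟨j, Or.inr rfl⟩
  have h3 := hh _ ⟨j, Or.inl rfl⟩
  have h4 := hh _ ⟨j, Or.inr rfl⟩
  rw [affEval_simple_zero] at g1 h3
  rw [affEval_neg_simple_one, delta_smul, hpκ] at g2 h4
  have k1 : k < 1 := by
    have : (k : ℝ) * κ < 1 * κ := by linarith
    exact_mod_cast lt_of_mul_lt_mul_right this hκ.le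
  have k2 : -1 < k := by
    have : (-1 : ℝ) * κ < k * κ := by linarith
    exact_mod_cast lt_of_mul_lt_mul_right this hκ.le
  have k0 : k = 0 := by lia
  subst k0
  simpa using h1

theorem liftRho_injective (hθ : IsLongestRoot b θ) : Function.Injective (liftRho b θ) :=
  fun _ _ h => eq_of_smul_rho_eq hθ (lift_injective b θ h)

/-- Strip a right descent `i` and induct on length. The crossed root is negative at `p`, where all
cube roots are positive, so the shorter element is still in the cube. -/
theorem InCube.obtainable (hθ : IsLongestRoot b θ) (hp : ∀ j, 0 < p j) (hκ : 0 < κ)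
    (hpκ : delta b θ ⬝ᵥ p = κ) {g : weylGroup (affineCartan b θ)} (hg : InCube b θ p g) :
    Obtainable (affineCartan b θ) (lift b θ (rho b)) (g⁻¹ • lift b θ (rho b)) := by
  generalize hn : length (affineCartan b θ) g = n
  induction n using Nat.strong_induction_on generalizing g with
  | _ n ih =>
  by_cases hg1 : g = 1
  · rw [hg1, inv_one, one_smul]
    exact Relation.ReflTransGen.refl
  obtain ⟨i, hi⟩ := exists_length_mul_lt _ hg1
  obtain ⟨a, ha⟩ := exists_affEval_eq_inv_smul b θ g i
  set g' := g * simpleReflection (affineCartan b θ) i with hg'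
  have hgg' : g' * simpleReflection (affineCartan b θ) i = g := by
    rw [hg', mul_assoc, simpleReflection_mul_self, mul_one]
  have hin : InCube b θ p g' := by
    refine hg.mul_simpleReflection hθ hp ha fun hc => ?_
    have h1 := inCube_one hθ hp a hc
    rw [one_smul, ha, ← length_lt_mul_iff hθ hp] at h1
    lia
  have hlt : (g'⁻¹ • lift b θ (rho b)) i < -1 := by
    rw [inv_smul_lift_rho_lt_iff hθ hp hκ hpκ hin, hgg']
    exact ⟨hg, hi⟩
  refine Relation.ReflTransGen.tail (ih _ (hn ▸ hi) hin rfl) ⟨i, hlt, ?_⟩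
  rw [← mul_simpleReflection_inv_smul, hgg']

theorem exists_inCube_of_obtainable (hθ : IsLongestRoot b θ) (hp : ∀ j, 0 < p j) (hκ : 0 < κ)
    (hpκ : delta b θ ⬝ᵥ p = κ) {v : Option b.support → ℝ}
    (h : Obtainable (affineCartan b θ) (lift b θ (rho b)) v) :
    ∃ g : weylGroup (affineCartan b θ), InCube b θ p g ∧ g⁻¹ • lift b θ (rho b) = v := by
  induction h with
  | refl => exact ⟨1, inCube_one hθ hp, by simp⟩
  | tail _ hstep ih =>
    obtain ⟨g, hg, rfl⟩ := ih
    obtain ⟨i, hlt, rfl⟩ := hstep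
    exact ⟨_, ((inv_smul_lift_rho_lt_iff hθ hp hκ hpκ hg i).mp hlt).1,
      mul_simpleReflection_inv_smul _ g i _⟩

end Injectivity

/-! ### Dimensions of simplex faces and adjacency of chambers. -/

section Facets

variable {I : Type*}

theorem finrank_vectorSpan_translate (C : Matrix I I ℤ) (g : weylGroup C) (A : Set (I → ℝ)) :
    Module.finrank ℝ (vectorSpan ℝ (translate C g A)) = Module.finrank ℝ (vectorSpan ℝ A) := by
  have := AffineMap.map_vectorSpan
    ((g : (I → ℝ) ≃ₗ[ℝ] (I → ℝ)) : (I → ℝ) →ₗ[ℝ] (I → ℝ)).toAffineMap (s := A)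
  rw [translate]
  change Module.finrank ℝ (vectorSpan ℝ (((g : (I → ℝ) ≃ₗ[ℝ] (I → ℝ)) :
    (I → ℝ) →ₗ[ℝ] (I → ℝ)).toAffineMap '' A)) = _
  rw [← this]
  exact LinearEquiv.finrank_map_eq (g : (I → ℝ) ≃ₗ[ℝ] (I → ℝ)) _

variable [Fintype I]

/-- From the relative interior point `q`, a small step in any direction allowed by the linear
equations stays in the face. -/
theorem vectorSpan_simplex_face {d : I → ℝ} {κ : ℝ} (S : Set I) {q : I → ℝ}
    (hq : d ⬝ᵥ q = κ) (hpos : ∀ j ∉ S, 0 < q j) (hzero : ∀ j ∈ S, q j = 0) (u : I → ℝ) :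
    u ∈ vectorSpan ℝ {v : I → ℝ | (d ⬝ᵥ v = κ ∧ ∀ j, 0 ≤ v j) ∧ ∀ j ∈ S, v j = 0} ↔
      d ⬝ᵥ u = 0 ∧ ∀ j ∈ S, u j = 0 := by
  constructor
  · intro h
    rw [vectorSpan_def] at h
    induction h using Submodule.span_induction with
    | mem x hx =>
      obtain ⟨v, hv, w, hw, rfl⟩ := hx
      refine ⟨?_, fun j hj => ?_⟩
      · simp only [vsub_eq_sub]
        rw [dotProduct_sub, hv.1.1, hw.1.1, sub_self]
      · simp only [vsub_eq_sub]
        rw [Pi.sub_apply, hv.2 j hj, hw.2 j hj, sub_self]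
    | zero => simp
    | add x y _ _ hx hy =>
      exact ⟨by rw [dotProduct_add, hx.1, hy.1, add_zero],
        fun j hj => by rw [Pi.add_apply, hx.2 j hj, hy.2 j hj, add_zero]⟩
    | smul c x _ hx =>
      exact ⟨by rw [dotProduct_smul, hx.1, smul_zero],
        fun j hj => by rw [Pi.smul_apply, hx.2 j hj, smul_zero]⟩
  · rintro ⟨h₁, h₂⟩
    have hev : ∀ᶠ ε in nhdsWithin (0 : ℝ) (Set.Ioi 0), ∀ j, 0 ≤ q j + ε * u j := by
      rw [Filter.eventually_all]
      intro j
      by_cases hj : j ∈ S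
      · simp [hzero j hj, h₂ j hj]
      · have hc : Filter.Tendsto (fun ε : ℝ => q j + ε * u j) (nhdsWithin 0 (Set.Ioi 0))
            (nhds (q j + 0 * u j)) :=
          (Continuous.tendsto (by fun_prop) 0).mono_left nhdsWithin_le_nhds
        filter_upwards [hc.eventually (lt_mem_nhds (show 0 < q j + 0 * u j by
          simpa using hpos j hj))] with ε hε using hε.le
    obtain ⟨ε, hε, hε0⟩ := (hev.and self_mem_nhdsWithin).exists
    have hq' : q ∈ {v : I → ℝ | (d ⬝ᵥ v = κ ∧ ∀ j, 0 ≤ v j) ∧ ∀ j ∈ S, v j = 0} := by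
      refine ⟨⟨hq, fun j => ?_⟩, hzero⟩
      by_cases hj : j ∈ S
      · exact (hzero j hj).ge
      · exact (hpos j hj).le
    have hw : q + ε • u ∈
        {v : I → ℝ | (d ⬝ᵥ v = κ ∧ ∀ j, 0 ≤ v j) ∧ ∀ j ∈ S, v j = 0} := by
      refine ⟨⟨?_, hε⟩, fun j hj => ?_⟩
      · rw [dotProduct_add, dotProduct_smul, h₁, hq, smul_zero, add_zero]
      · simp [hzero j hj, h₂ j hj]
    have := vsub_mem_vectorSpan ℝ hw hq'
    rw [vsub_eq_sub, add_sub_cancel_left] at this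
    exact (Submodule.smul_mem_iff _ (ne_of_gt hε0)).mp this

theorem exists_simplex_face_point {d : I → ℝ} (hd : ∀ j, 0 < d j) {κ : ℝ} (hκ : 0 < κ) {S : Set I}
    (hS : ∃ j, j ∉ S) : ∃ q : I → ℝ, d ⬝ᵥ q = κ ∧ (∀ j ∉ S, 0 < q j) ∧ ∀ j ∈ S, q j = 0 := by
  classical
  obtain ⟨j₀, hj₀⟩ := hS
  let e : I → ℝ := fun j => if j ∈ S then 0 else 1
  have hpos : 0 < d ⬝ᵥ e := by
    refine Finset.sum_pos' (fun j _ => mul_nonneg (hd j).le ?_)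
      ⟨j₀, Finset.mem_univ _, by simpa [e, hj₀] using hd j₀⟩
    simp only [e]
    split_ifs <;> norm_num
  refine ⟨(κ / (d ⬝ᵥ e)) • e, ?_, fun j hj => ?_, fun j hj => ?_⟩
  · rw [dotProduct_smul, smul_eq_mul, div_mul_cancel₀ _ hpos.ne']
  · simpa [e, hj] using div_pos hκ hpos
  · simp [e, hj]

/-- The facet's direction space is the kernel of the `i`-th coordinate on that of the simplex; this
functional is nonzero at `d_j e_i - d_i e_j`. -/
theorem finrank_simplex_facet [Nontrivial I] {d : I → ℝ} (hd : ∀ j, 0 < d j) {κ : ℝ} (hκ : 0 < κ)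
    (i : I) :
    Module.finrank ℝ (vectorSpan ℝ {v : I → ℝ | (d ⬝ᵥ v = κ ∧ ∀ j, 0 ≤ v j) ∧ v i = 0}) + 1 =
      Module.finrank ℝ (vectorSpan ℝ {v : I → ℝ | d ⬝ᵥ v = κ ∧ ∀ j, 0 ≤ v j}) := by
  classical
  obtain ⟨j, hji⟩ := exists_ne i
  obtain ⟨q₀, hq₀, hq₀', hq₀''⟩ := exists_simplex_face_point hd hκ (S := ∅) ⟨i, by simp⟩
  obtain ⟨q₁, hq₁, hq₁', hq₁''⟩ := exists_simplex_face_point hd hκ (S := {i}) ⟨j, by simpa⟩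
  have h₀ := vectorSpan_simplex_face ∅ hq₀ hq₀' hq₀''
  have h₁ := vectorSpan_simplex_face {i} hq₁ hq₁' hq₁''
  simp only [Set.mem_empty_iff_false, false_implies, implies_true, and_true,
    Set.mem_singleton_iff, forall_eq] at h₀ h₁
  set D := vectorSpan ℝ {v : I → ℝ | d ⬝ᵥ v = κ ∧ ∀ j, 0 ≤ v j}
  let f : D →ₗ[ℝ] ℝ := (LinearMap.proj i).comp D.subtype
  have hmap : (LinearMap.ker f).map D.subtype =
      vectorSpan ℝ {v : I → ℝ | (d ⬝ᵥ v = κ ∧ ∀ j, 0 ≤ v j) ∧ v i = 0} := by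
    ext u
    rw [h₁]
    constructor
    · rintro ⟨⟨u, hu⟩, hf, rfl⟩
      exact ⟨(h₀ u).mp hu, hf⟩
    · rintro ⟨hu, hui⟩
      exact ⟨⟨u, (h₀ u).mpr hu⟩, hui, rfl⟩
  have hf : f ≠ 0 := by
    intro h
    have hmem : d j • Pi.single i (1 : ℝ) - d i • Pi.single j (1 : ℝ) ∈ D := by
      rw [h₀]
      simp [dotProduct_sub, mul_comm]
    have := LinearMap.congr_fun h ⟨_, hmem⟩
    simp [f, hji.symm, (hd j).ne'] at this
  rw [← hmap, LinearEquiv.finrank_eq (Submodule.equivSubtypeMap D (LinearMap.ker f)).symm]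
  exact Module.Dual.finrank_ker_add_one_of_ne_zero hf

/-- A common point `g v = g s_i w` has `v i = -w i` with both coordinates nonnegative, so they
vanish. -/
theorem translate_inter_translate_mul (C : Matrix I I ℤ) {d : I → ℝ} {κ : ℝ}
    (g : weylGroup C) (i : I)
    (hfix : ∀ v : I → ℝ, v i = 0 → fire C i v = v) :
    translate C g {v | d ⬝ᵥ v = κ ∧ ∀ j, 0 ≤ v j} ∩
      translate C (g * simpleReflection C i) {v | d ⬝ᵥ v = κ ∧ ∀ j, 0 ≤ v j} =
    translate C g {v | (d ⬝ᵥ v = κ ∧ ∀ j, 0 ≤ v j) ∧ v i = 0} := by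
  ext x
  constructor
  · rintro ⟨⟨v, hv, rfl⟩, ⟨w, hw, hvw⟩⟩
    refine ⟨v, ⟨hv, ?_⟩, rfl⟩
    have h1 : fire C i w = v := by
      have h2 : (g * simpleReflection C i) • w = g • v := hvw
      rw [mul_smul] at h2
      exact smul_left_cancel g h2
    have h2 := fire_self C i w
    rw [h1] at h2
    linarith [hv.2 i, hw.2 i]
  · rintro ⟨v, ⟨hv, hvi⟩, rfl⟩
    refine ⟨⟨v, hv, rfl⟩, ⟨v, hv, ?_⟩⟩
    change (g * simpleReflection C i) • v = g • v
    rw [mul_smul, simpleReflection_smul, hfix v hvi]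

theorem shareFacet_translate [Nontrivial I] (C : Matrix I I ℤ) {d : I → ℝ} (hd : ∀ j, 0 < d j)
    {κ : ℝ} (hκ : 0 < κ) (g : weylGroup C) (i : I) :
    ShareFacet (translate C g {v | d ⬝ᵥ v = κ ∧ ∀ j, 0 ≤ v j})
      (translate C (g * simpleReflection C i) {v | d ⬝ᵥ v = κ ∧ ∀ j, 0 ≤ v j}) := by
  have hfix : ∀ v : I → ℝ, v i = 0 → fire C i v = v := by
    intro v hv
    funext j
    by_cases h : j = i
    · subst h; simp [fire_self, hv]
    · simp [fire, fireFun, h, hv]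
  rw [ShareFacet, translate_inter_translate_mul C g i hfix, finrank_vectorSpan_translate,
    finrank_vectorSpan_translate, finrank_vectorSpan_translate]
  refine ⟨?_, finrank_simplex_facet hd hκ i, finrank_simplex_facet hd hκ i⟩
  obtain ⟨j, hji⟩ := exists_ne i
  obtain ⟨q, h₁, h₂, h₃⟩ := exists_simplex_face_point hd hκ (S := {i}) ⟨j, by simpa⟩
  refine ⟨_, q, ⟨⟨h₁, fun k => ?_⟩, h₃ i rfl⟩, rfl⟩
  by_cases hk : k = i
  · exact (h₃ k hk).ge
  · exact (h₂ k hk).le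

end Facets

/-! ### The two bijections and the matching of edges. -/

section Main

variable {ι M N : Type*} [AddCommGroup M] [Module ℝ M] [AddCommGroup N] [Module ℝ N]
  {P : RootPairing ι ℝ M N} [P.IsRootSystem] [P.IsCrystallographic]
  [Finite ι] [P.IsReduced] [P.IsIrreducible] {b : P.Base} {θ : ι}
  {p : Option b.support → ℝ} {κ : ℝ}

theorem delta_pos (hθ : IsLongestRoot b θ) (j : Option b.support) : 0 < delta b θ j := by
  cases j with
  | none => exact one_pos
  | some i => exact hθ.rootCoeff_pos i

theorem sUnion_chambersIn (hθ : IsLongestRoot b θ) (hp : ∀ j, 0 < p j) (hκ : 0 < κ)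
    (hpκ : delta b θ ⬝ᵥ p = κ) :
    ⋃₀ chambersIn (affineCartan b θ) (dominantChamber b θ κ) (unitHypercube b θ κ) =
      unitHypercube b θ κ := by
  refine Set.Subset.antisymm (Set.sUnion_subset fun A hA => hA.2) fun v hv => ?_
  obtain ⟨g, hg, hnn⟩ := exists_inCube_inv_smul_nonneg hθ hp hκ hv
  refine ⟨translate (affineCartan b θ) g (dominantChamber b θ κ), ⟨⟨g, rfl⟩,
    (translate_subset_unitHypercube_iff hθ hp hpκ g).mpr hg⟩, g⁻¹ • v, ⟨?_, hnn⟩, ?_⟩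
  · exact (delta_smul b θ g⁻¹ v).trans hv.1
  · exact smul_inv_smul g v

theorem translate_dominantChamber_injective (hθ : IsLongestRoot b θ) (hp : ∀ j, 0 < p j)
    (hpκ : delta b θ ⬝ᵥ p = κ) : Function.Injective fun g : weylGroup (affineCartan b θ) =>
      translate (affineCartan b θ) g (dominantChamber b θ κ) := by
  intro g h e
  have hmem : g • p ∈ translate (affineCartan b θ) h (dominantChamber b θ κ) := by
    have e' : translate (affineCartan b θ) g (dominantChamber b θ κ) =
      translate (affineCartan b θ) h (dominantChamber b θ κ) := e
    rw [← e']
    exact ⟨p, ⟨hpκ, fun j => (hp j).le⟩, rfl⟩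
  obtain ⟨v, hv, hgv⟩ := hmem
  exact eq_of_smul_eq_smul_nonneg hθ hp hv.2 hgv.symm

/-- The chambers in the hypercube are in bijection with the elements of `W` which map `p` into
its interior. -/
noncomputable def chamberEquiv (hθ : IsLongestRoot b θ) (hp : ∀ j, 0 < p j)
    (hpκ : delta b θ ⬝ᵥ p = κ) : {g // InCube b θ p g} ≃
      chambersIn (affineCartan b θ) (dominantChamber b θ κ) (unitHypercube b θ κ) :=
  Equiv.ofBijective (fun g => ⟨translate (affineCartan b θ) g (dominantChamber b θ κ),
    ⟨g, rfl⟩, (translate_subset_unitHypercube_iff hθ hp hpκ g).mpr g.2⟩) <| by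
  refine ⟨fun g h e => Subtype.ext
    (translate_dominantChamber_injective hθ hp hpκ (congrArg Subtype.val e)), ?_⟩
  rintro ⟨A, ⟨g, rfl⟩, hA⟩
  exact ⟨⟨g, (translate_subset_unitHypercube_iff hθ hp hpκ g).mp hA⟩, rfl⟩

/-- The set `W₀^{(i₀)}` is in bijection with the elements of `W` which map `p` into the interior of
the hypercube. -/
noncomputable def firingEquiv (hθ : IsLongestRoot b θ) (hp : ∀ j, 0 < p j) (hκ : 0 < κ)
    (hpκ : delta b θ ⬝ᵥ p = κ) : {g // InCube b θ p g} ≃ W0i0 b θ :=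
  Equiv.ofBijective (fun g => ⟨(exists_liftRho_eq b θ g.1).choose, by
    change Obtainable _ _ _
    rw [(exists_liftRho_eq b θ g.1).choose_spec]
    exact g.2.obtainable hθ hp hκ hpκ⟩) <| by
  constructor
  · intro g h e
    have e' := congrArg (liftRho b θ) (congrArg Subtype.val e)
    simp only [(exists_liftRho_eq b θ g.1).choose_spec,
      (exists_liftRho_eq b θ h.1).choose_spec] at e'
    exact Subtype.ext (eq_of_inv_smul_lift_rho_eq hθ hp hκ hpκ g.2 h.2 e')
  · rintro ⟨g', hg'⟩
    obtain ⟨g, hg, e⟩ := exists_inCube_of_obtainable hθ hp hκ hpκ hg'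
    refine ⟨⟨g, hg⟩, Subtype.ext (liftRho_injective hθ ?_)⟩
    rw [← e]
    exact (exists_liftRho_eq b θ g).choose_spec

theorem liftRho_firingEquiv (hθ : IsLongestRoot b θ) (hp : ∀ j, 0 < p j) (hκ : 0 < κ)
    (hpκ : delta b θ ⬝ᵥ p = κ) (g : {g // InCube b θ p g}) :
    liftRho b θ (firingEquiv hθ hp hκ hpκ g) = g.1⁻¹ • lift b θ (rho b) :=
  (exists_liftRho_eq b θ g.1).choose_spec

theorem firingDigraph_adj_iff (hθ : IsLongestRoot b θ) (hp : ∀ j, 0 < p j) (hκ : 0 < κ)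
    (hpκ : delta b θ ⬝ᵥ p = κ) (g h : {g // InCube b θ p g}) :
    (firingDigraph b θ).Adj (firingEquiv hθ hp hκ hpκ g) (firingEquiv hθ hp hκ hpκ h) ↔
      ∃ i, h.1 = g.1 * simpleReflection (affineCartan b θ) i ∧
        length (affineCartan b θ) g.1 < length (affineCartan b θ) h.1 := by
  change FiresTo _ _ _ ↔ _
  rw [FiresTo, liftRho_firingEquiv, liftRho_firingEquiv]
  refine exists_congr fun i => ?_
  rw [inv_smul_lift_rho_lt_iff hθ hp hκ hpκ g.2, ← mul_simpleReflection_inv_smul]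
  constructor
  · rintro ⟨⟨h₁, h₂⟩, h₃⟩
    -- A firing determines only a configuration; injectivity on the cube identifies the group
    -- element as `g s_i`.
    have e := eq_of_inv_smul_lift_rho_eq hθ hp hκ hpκ h.2 h₁ h₃
    exact ⟨e, e ▸ h₂⟩
  · rintro ⟨e, h₂⟩
    rw [← e]
    exact ⟨⟨h.2, h₂⟩, rfl⟩

theorem dualDigraph_adj_iff (hθ : IsLongestRoot b θ) (hp : ∀ j, 0 < p j) (hκ : 0 < κ)
    (hpκ : delta b θ ⬝ᵥ p = κ) (g h : {g // InCube b θ p g}) :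
    (dualDigraph (affineCartan b θ) (dominantChamber b θ κ) (unitHypercube b θ κ)).Adj
      (chamberEquiv hθ hp hpκ g) (chamberEquiv hθ hp hpκ h) ↔
      ∃ i, h.1 = g.1 * simpleReflection (affineCartan b θ) i ∧
        length (affineCartan b θ) g.1 < length (affineCartan b θ) h.1 := by
  have hinj := translate_dominantChamber_injective hθ hp hpκ
  constructor
  · rintro ⟨-, g', i, h₁, h₂, h₃⟩
    obtain rfl : g.1 = g' := hinj h₁
    have e : h.1 = g.1 * simpleReflection (affineCartan b θ) i := hinj h₂
    exact ⟨i, e, e ▸ h₃⟩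
  · rintro ⟨i, e, hlt⟩
    have : Nonempty ι := ⟨θ⟩
    -- This gives the extended graph at least two vertices, so that chambers have nonempty facets.
    have : Nonempty b.support := b.support_nonempty.to_subtype
    refine ⟨?_, g.1, i, rfl, congrArg
      (fun x => translate (affineCartan b θ) x (dominantChamber b θ κ)) e, e ▸ hlt⟩
    have hs := shareFacet_translate (affineCartan b θ) (delta_pos hθ) hκ g.1 i
    rw [← e] at hs
    exact hs

end Main

end NumbersGame

theorem mainTheorem5
    {ι M N : Type*} [Finite ι] [AddCommGroup M] [Module ℝ M] [AddCommGroup N] [Module ℝ N]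
    (P : RootPairing ι ℝ M N) [P.IsRootSystem] [P.IsCrystallographic] [P.IsReduced]
    [P.IsIrreducible] (b : P.Base) (θ : ι) (hθ : NumbersGame.IsLongestRoot b θ)
    (κ : ℝ) (hκ : 0 < κ) :
    -- the hypercube is the union of the Weyl chambers contained in it
    ⋃₀ NumbersGame.chambersIn (NumbersGame.affineCartan b θ)
        (NumbersGame.dominantChamber b θ κ) (NumbersGame.unitHypercube b θ κ) =
      NumbersGame.unitHypercube b θ κ ∧
    -- its dual directed graph is isomorphic to the graph of firings
    Nonempty ((NumbersGame.firingDigraph b θ).Adj ≃r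
      (NumbersGame.dualDigraph (NumbersGame.affineCartan b θ)
        (NumbersGame.dominantChamber b θ κ) (NumbersGame.unitHypercube b θ κ)).Adj) := by
  -- With `S = ∅` the face is the whole dominant chamber, so `p` is an interior point.
  obtain ⟨p, hpκ, hp, -⟩ := NumbersGame.exists_simplex_face_point (NumbersGame.delta_pos hθ) hκ
    (S := ∅) ⟨none, Set.notMem_empty _⟩
  replace hp : ∀ j, 0 < p j := fun j => hp j (Set.notMem_empty j)
  refine ⟨NumbersGame.sUnion_chambersIn hθ hp hκ hpκ,
    ⟨((NumbersGame.firingEquiv hθ hp hκ hpκ).symm.trans (NumbersGame.chamberEquiv hθ hp hpκ)),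
      fun {x y} => ?_⟩⟩
  obtain ⟨g, rfl⟩ := (NumbersGame.firingEquiv hθ hp hκ hpκ).surjective x
  obtain ⟨h, rfl⟩ := (NumbersGame.firingEquiv hθ hp hκ hpκ).surjective y
  rw [NumbersGame.firingDigraph_adj_iff hθ hp hκ hpκ]
  simp only [Equiv.trans_apply, Equiv.symm_apply_apply]
  exact NumbersGame.dualDigraph_adj_iff hθ hp hκ hpκ g h
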